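/- Theorem (Regret bound of DBL-MNL). Setting. There are $N$ items, assortments are the sets $S\subseteq[N]$ with $|S|\le K$, where $1\le K\le N$, and $d\ge 1$. In round $t=1,2,\dots$ the agent observes feature vectors $x_{t1},\dots,x_{tN}\in\mathbb R^d$, offers an assortment $S_t$ and observes a choice $c_t\in S_t\cup\{0\}$. Given the past, the features and $S_t$, it equals $i\in S_t\cup\{0\}$ with the MNL probability $p_t(i\mid S_t,\theta^*)$, where $p_t(i\mid S,\theta)=\frac{\exp(x_{ti}^\top\theta)}{1+\sum_{j\in S}\exp(x_{tj}^\top\theta)}$ for $i\in S$ and $p_t(0\mid S,\theta)=\frac{1}{1+\sum_{j\in S}\exp(x_{tj}^\top\theta)}$. All items have the same revenue $r\in[-1,1]$; $R_t(S,\theta)=\sum_{i\in S}r\,p_t(i\mid S,\theta)$, and $\mathcal R_T=\mathbb E\big[\sum_{t=1}^T(\max_{|S|\le K}R_t(S,\theta^*)-R_t(S_t,\theta^*))\big]$. Assumptions, for constants $\sigma_0,\kappa>0$ and $\rho_0<\infty$. (1) The $x_{ti}$ are i.i.d. with law $p_X$, drawn in round $t$ independently of the past, $\|x_{ti}\|\le1$,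 and $\mathbb E[x_{ti}x_{ti}^\top]\succeq\sigma_0 I$. (2) Almost surely $p_t(i\mid S,\theta)\,p_t(0\mid S,\theta)\ge\kappa$ for all $t$, all $|S|\le K$, all $i\in S$ and all $\|\theta-\theta^*\|\le1$. (3) $p_X(-x)/p_X(x)\le\rho_0$ for all $x$ (that is, $p_X(-A)\le\rho_0\,p_X(A)$ for all measurable $A$). (4) $K\le 18/\kappa^4$. Algorithm DBL-MNL. Put $\tau_0=0$, $\tau_1=d$, $\tau_k=2^{k-1}$ for $k\ge2$, $\alpha_k=\frac5\kappa\sqrt{\log(\tau_k^2N/4)}$ and $q_k=\frac{288}{K\sigma_0\kappa^4}\big(4d^2+\log(\tau_k^2N/4)\big)$. In the rounds $t\le d$, $S_t$ is uniformly random among the sets of exactly $K$ items. A round $t>d$ belongs to the episode $k\ge2$ with $\tau_{k-1}<t\le\tau_k$. Let $W_{k-1}=\sum_{s=\tau_{k-2}+1}^{\tau_{k-1}}\sum_{i\in S_s}x_{si}x_{si}^\top$ and $V_t=\sum_{s=\tau_{k-1}+1}^{t-1}\sum_{i\in S_s}x_{si}x_{si}^\top$, and let $\hat\theta_k$ be an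 MLE, i.e. a solution, computed from the observations in the rounds up to $\tau_{k-1}$, of $\sum_{s=\tau_{k-2}+1}^{\tau_{k-1}}\sum_{i\in S_s}(p_s(i\mid S_s,\theta)-\mathbf 1\{c_s=i\})x_{si}=0$ (arbitrary if there is none). If $\tau_k-t\le q_k$ and $\lambda_{\min}(V_t)\le Kq_k\sigma_0/2$, then $S_t$ is uniformly random among the sets of exactly $K$ items; otherwise $S_t$ maximizes $\sum_{i\in S}r e^{z_{ti}}/(1+\sum_{j\in S}e^{z_{tj}})$ over $|S|\le K$, with ties broken by a fixed rule depending on $(z_{ti})_i$ only, where $z_{ti}=x_{ti}^\top\hat\theta_k+\alpha_k\|x_{ti}\|_{W_{k-1}^{-1}}$ (and $W_{k-1}^{-1}:=0$ if $W_{k-1}$ is singular). Claim. For all $T>d$, $$\mathcal R_T\le C\,\sqrt{d\,T\,\log(T/d)\,\log(TN)\,\log T}.$$ Here $C$ depends only on $\kappa,\sigma_0,\rho_0$ and on a diversity constant $M$ of the context distribution, namely any $M$ such that, for i.i.d. $X_1,\dots,X_N\sim p_X$, every $\theta\in\mathbb R^d$, every positive semidefinite $A$ and every measurable choice $S$ of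 $K$ indices with the highest scores $X_i^\top\theta+\|X_i\|_A$, one has $M\,\mathbb E\big[\sum_{i\in S}X_iX_i^\top\big]\succeq K\,\mathbb E[X_1X_1^\top]$. Such an $M$ always exists: one can be chosen that depends only on $N,\kappa,\sigma_0,\rho_0$. -/

import Mathlib

open MeasureTheory ProbabilityTheory

namespace DBLMNL

noncomputable section

/-- Feature vectors and parameters: `ℝ^d` with the Euclidean norm. -/
abbrev Vec (d : ℕ) : Type := EuclideanSpace ℝ (Fin d)

/-! ### The multinomial logit choice model -/

/-- Linear utilities `x_i ⬝ θ` of the `N` items with feature vectors `X`. -/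
def utility {N d : ℕ} (X : Fin N → Vec d) (θ : Vec d) : Fin N → ℝ :=
  fun i => inner ℝ (X i) θ

/-- MNL choice probabilities for the assortment `S` under the utilities `u`.
`none` is the outside option, `some i` is the purchase of item `i`. -/
def choiceProb {N : ℕ} (u : Fin N → ℝ) (S : Finset (Fin N)) : Option (Fin N) → ℝ
  | none => 1 / (1 + ∑ j ∈ S, Real.exp (u j))
  | some i => if i ∈ S then Real.exp (u i) / (1 + ∑ j ∈ S, Real.exp (u j)) else 0

/-- The feasible assortments: sets of at most `K` items. -/
def assortments (N K : ℕ) : Finset (Finset (Fin N)) :=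
  Finset.univ.filter fun S => S.card ≤ K

/-- Expected revenue of the assortment `S` for item revenues `r` and utilities `u`. -/
def revenue {N : ℕ} (r : Fin N → ℝ) (u : Fin N → ℝ) (S : Finset (Fin N)) : ℝ :=
  ∑ i ∈ S, r i * choiceProb u S (some i)

/-- The empty assortment is feasible. -/
theorem assortments_nonempty (N K : ℕ) : (assortments N K).Nonempty :=
  ⟨∅, by simp [assortments]⟩

/-- The revenue of an offline optimal assortment. -/
def optRevenue {N : ℕ} (K : ℕ) (r : Fin N → ℝ) (u : Fin N → ℝ) : ℝ :=
  (assortments N K).sup' (assortments_nonempty N K) (revenue r u)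

/-! ### Statistics of a sample path

A sample path consists of the contexts `x t i`, the assortments `S t` and the choices `c t`
in the rounds `t = 1, 2, …`. -/

/-- Gram matrix of the feature vectors of the items offered in the rounds of `I`. -/
def gram {N d : ℕ} (x : ℕ → Fin N → Vec d) (S : ℕ → Finset (Fin N)) (I : Finset ℕ) :
    Matrix (Fin d) (Fin d) ℝ :=
  ∑ t ∈ I, ∑ i ∈ S t, Matrix.vecMulVec (x t i).ofLp (x t i).ofLp

/-- Gradient at `θ` of the negative log-likelihood of the choices in the rounds of `I`. -/
def score {N d : ℕ} (x : ℕ → Fin N → Vec d) (S : ℕ → Finset (Fin N))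
    (c : ℕ → Option (Fin N)) (I : Finset ℕ) (θ : Vec d) : Vec d :=
  ∑ t ∈ I, ∑ i ∈ S t,
    (choiceProb (utility (x t) θ) (S t) (some i) - (if c t = some i then 1 else 0)) • x t i

/-- Smallest eigenvalue of a real symmetric matrix. -/
def lamMin {d : ℕ} (V : Matrix (Fin d) (Fin d) ℝ) : ℝ := sInf (spectrum ℝ V)

/-- The weighted norm `‖v‖_V = √(vᵀ V v)`. -/
def weightedNorm {d : ℕ} (V : Matrix (Fin d) (Fin d) ℝ) (v : Vec d) : ℝ :=
  Real.sqrt (v.ofLp ⬝ᵥ (V.mulVec v.ofLp))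

/-! ### The algorithm DBL-MNL -/

/-- Last round of episode `k`: `τ_0 = 0`, `τ_1 = d`, and `τ_k = 2 ^ (k - 1)` for `k ≥ 2`. -/
def tau (d k : ℕ) : ℕ := if k = 0 then 0 else if k = 1 then d else 2 ^ (k - 1)

/-- The episode of a round `t > d`: the least `k` with `t ≤ 2 ^ (k - 1)`.
The rounds `t ≤ d` form the initialization. -/
def episode (t : ℕ) : ℕ := Nat.clog 2 t + 1

/-- The confidence radius `α_k`. -/
def alpha (N d : ℕ) (κ : ℝ) (k : ℕ) : ℝ :=
  5 / κ * Real.sqrt (Real.log ((tau d k : ℝ) ^ 2 * N / 4))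

/-- The sampling parameter `q_k`. -/
def qParam (N d K : ℕ) (κ σ₀ : ℝ) (k : ℕ) : ℝ :=
  288 / (K * σ₀ * κ ^ 4) * (4 * (d : ℝ) ^ 2 + Real.log ((tau d k : ℝ) ^ 2 * N / 4))

/-- The rounds in which a random assortment is offered: the initialization, and those rounds at
the end of an episode where the Gram matrix of the earlier rounds of that episode is still
too small. -/
def Explores {N d : ℕ} (K : ℕ) (κ σ₀ : ℝ) (x : ℕ → Fin N → Vec d)
    (S : ℕ → Finset (Fin N)) (t : ℕ) : Prop :=
  t ≤ d ∨
    ((tau d (episode t) : ℝ) - t ≤ qParam N d K κ σ₀ (episode t) ∧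
      lamMin (gram x S (Finset.Ioo (tau d (episode t - 1)) t)) ≤
        K * qParam N d K κ σ₀ (episode t) * σ₀ / 2)

/-- Optimistic utilities in a round `t` of episode `k`: the estimate of episode `k` plus `α_k`
times the norm weighted by the inverse of the Gram matrix of episode `k - 1`. The inverse of a
singular matrix is `0`, so that there is no bonus in this case. -/
def optimisticUtility {N d : ℕ} (κ : ℝ) (x : ℕ → Fin N → Vec d) (S : ℕ → Finset (Fin N))
    (θhat : ℕ → Vec d) (t : ℕ) : Fin N → ℝ := fun i =>
  inner ℝ (x t i) (θhat (episode t)) +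
    alpha N d κ (episode t) *
      weightedNorm
        (gram x S (Finset.Ioc (tau d (episode t - 2)) (tau d (episode t - 1))))⁻¹ (x t i)

/-- An assortment optimization method: a measurable rule that returns, for given utilities, a
feasible assortment of maximal revenue (ties are broken by the rule). -/
structure IsArgmaxRule {N : ℕ} (K : ℕ) (r : Fin N → ℝ)
    (sel : (Fin N → ℝ) → Finset (Fin N)) : Prop where
  measurable : ∀ A, MeasurableSet (sel ⁻¹' {A})
  feasible : ∀ z, sel z ∈ assortments N K
  optimal : ∀ z, ∀ A ∈ assortments N K, revenue r z A ≤ revenue r z (sel z)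

/-! ### The stochastic processes -/

section Runs

variable {Ω : Type*} {N d : ℕ}

/-- The σ-algebra of everything observed (contexts, assortments, choices) before round `t`. -/
@[reducible] def history (x : ℕ → Ω → Fin N → Vec d) (S : ℕ → Ω → Finset (Fin N))
    (c : ℕ → Ω → Option (Fin N)) (t : ℕ) : MeasurableSpace Ω :=
  ⨆ s ∈ Finset.Ico 1 t,
    (MeasurableSpace.comap (x s) inferInstance ⊔ MeasurableSpace.comap (S s) ⊤ ⊔
      MeasurableSpace.comap (c s) ⊤)

/-- The environment of the bandit problem. In each round the contexts of the `N` items are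
independent draws from `p`, independent of the past; given the past, the contexts and
the offered assortment, the choice follows the MNL model with parameter `θstar`. -/
structure IsEnvironment [MeasurableSpace Ω] (P : Measure Ω) (p : Measure (Vec d))
    (θstar : Vec d) (x : ℕ → Ω → Fin N → Vec d) (S : ℕ → Ω → Finset (Fin N))
    (c : ℕ → Ω → Option (Fin N)) : Prop where
  measurable_context : ∀ t, Measurable (x t)
  measurable_choice : ∀ t a, MeasurableSet (c t ⁻¹' {a})
  context_law : ∀ t, 1 ≤ t → P.map (x t) = Measure.pi fun _ : Fin N => p
  context_indep : ∀ t, 1 ≤ t →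
    Indep (MeasurableSpace.comap (x t) inferInstance) (history x S c t) P
  choice_law : ∀ t, 1 ≤ t → ∀ a,
    P⟦c t ⁻¹' {a} |
        history x S c t ⊔ MeasurableSpace.comap (x t) inferInstance ⊔
          MeasurableSpace.comap (S t) ⊤⟧
      =ᵐ[P] fun ω => choiceProb (utility (x t ω) θstar) (S t ω) a

/-- The assortments `S` are offered by DBL-MNL. `θhat k` is the maximum likelihood estimate used
in episode `k`: it is computed from the past and is a zero of the score of the data of
episode `k - 1` whenever the score has a zero. In an exploration round the assortment is uniform
among the sets of exactly `K` items, given the past and the contexts; in all other rounds it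
maximizes the optimistic revenue. -/
structure IsDBLMNL [MeasurableSpace Ω] (P : Measure Ω) (K : ℕ) (κ σ₀ : ℝ)
    (sel : (Fin N → ℝ) → Finset (Fin N))
    (x : ℕ → Ω → Fin N → Vec d) (S : ℕ → Ω → Finset (Fin N))
    (c : ℕ → Ω → Option (Fin N)) (θhat : ℕ → Ω → Vec d) : Prop where
  measurable_assortment : ∀ t A, MeasurableSet (S t ⁻¹' {A})
  measurable_estimate : ∀ k, 2 ≤ k →
    Measurable[history x S c (tau d (k - 1) + 1)] (θhat k)
  estimate : ∀ k, 2 ≤ k → ∀ᵐ ω ∂P,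
    (∃ θ, score (fun t => x t ω) (fun t => S t ω) (fun t => c t ω)
      (Finset.Ioc (tau d (k - 2)) (tau d (k - 1))) θ = 0) →
    score (fun t => x t ω) (fun t => S t ω) (fun t => c t ω)
      (Finset.Ioc (tau d (k - 2)) (tau d (k - 1))) (θhat k ω) = 0
  explore : ∀ t, 1 ≤ t → ∀ A : Finset (Fin N), A.card = K → ∀ᵐ ω ∂P,
    Explores K κ σ₀ (fun s => x s ω) (fun s => S s ω) t →
      (P⟦S t ⁻¹' {A} |
        history x S c t ⊔ MeasurableSpace.comap (x t) inferInstance⟧) ω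
        = 1 / (N.choose K : ℝ)
  exploit : ∀ t, 1 ≤ t → ∀ᵐ ω ∂P,
    ¬ Explores K κ σ₀ (fun s => x s ω) (fun s => S s ω) t →
      S t ω = sel (optimisticUtility κ (fun s => x s ω) (fun s => S s ω)
        (fun k => θhat k ω) t)

/-- The cumulative regret over `T` rounds on a sample path. -/
def regret (K : ℕ) (r : Fin N → ℝ) (θstar : Vec d) (x : ℕ → Ω → Fin N → Vec d)
    (S : ℕ → Ω → Finset (Fin N)) (T : ℕ) (ω : Ω) : ℝ :=
  ∑ t ∈ Finset.Icc 1 T,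
    (optRevenue K r (utility (x t ω) θstar) - revenue r (utility (x t ω) θstar) (S t ω))

end Runs

/-! ### Assumptions on the context distribution -/

/-- The matrix `𝔼[x xᵀ]` for `x ∼ p`. -/
def secondMoment {d : ℕ} (p : Measure (Vec d)) : Matrix (Fin d) (Fin d) ℝ :=
  Matrix.of fun i j => ∫ y, y i * y j ∂p

/-- Contexts in the unit ball with `𝔼[x xᵀ] ⪰ σ₀ I`. -/
structure BoundedContexts {d : ℕ} (p : Measure (Vec d)) (σ₀ : ℝ) : Prop where
  norm_le_one : ∀ᵐ y ∂p, ‖y‖ ≤ 1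
  secondMoment_ge : (secondMoment p - σ₀ • (1 : Matrix (Fin d) (Fin d) ℝ)).PosSemidef

/-- For almost all contexts of a round, `p(i | S, θ) p(0 | S, θ) ≥ κ` for every feasible
assortment `S`, every `i ∈ S` and every `θ` at distance at most `1` from `θstar`. -/
def ChoiceProbBound {d : ℕ} (N K : ℕ) (p : Measure (Vec d)) (θstar : Vec d) (κ : ℝ) : Prop :=
  ∀ᵐ X ∂(Measure.pi fun _ : Fin N => p), ∀ A ∈ assortments N K, ∀ i ∈ A, ∀ θ : Vec d,
    ‖θ - θstar‖ ≤ 1 →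
      κ ≤ choiceProb (utility X θ) A (some i) * choiceProb (utility X θ) A none

/-- Relaxed symmetry `p(-x) / p(x) ≤ ρ₀`, as a domination of measures; it covers densities
with respect to any reflection invariant reference measure (Lebesgue, counting, …). -/
def RelaxedSymmetry {d : ℕ} (p : Measure (Vec d)) (ρ₀ : ℝ) : Prop :=
  p.map (fun y => -y) ≤ ENNReal.ofReal ρ₀ • p

/-- `A` consists of `K` items with the highest scores `z`. -/
def IsTopSet {N : ℕ} (K : ℕ) (z : Fin N → ℝ) (A : Finset (Fin N)) : Prop :=
  A.card = K ∧ ∀ i ∈ A, ∀ j ∉ A, z j ≤ z i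

/-- The expected Gram matrix of the items picked by the rule `pick` from `N` independent
contexts with law `p`. -/
def expectedGram {N d : ℕ} (p : Measure (Vec d))
    (pick : (Fin N → Vec d) → Finset (Fin N)) : Matrix (Fin d) (Fin d) ℝ :=
  Matrix.of fun a b => ∫ X, ∑ i ∈ pick X, X i a * X i b ∂(Measure.pi fun _ : Fin N => p)

/-- `M` is a diversity constant of the context distribution: picking, among `N` independent
contexts, the `K` ones with the highest scores `y ↦ ⟪y, θ⟫ + ‖y‖_A` loses, compared with picking
`K` contexts at random, at most a factor `M` in the expected Gram matrix. -/
def DiversityConstant {d : ℕ} (N K : ℕ) (p : Measure (Vec d)) (M : ℝ) : Prop :=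
  ∀ (θ : Vec d) (A : Matrix (Fin d) (Fin d) ℝ), A.PosSemidef →
    ∀ pick : (Fin N → Vec d) → Finset (Fin N), (∀ B, MeasurableSet (pick ⁻¹' {B})) →
      (∀ X, IsTopSet K (fun i => inner ℝ (X i) θ + weightedNorm A (X i)) (pick X)) →
        (M • expectedGram p pick - (K : ℝ) • secondMoment p).PosSemidef

end

end DBLMNL

namespace DBLMNL

noncomputable section

/-! ### The choice model and the revenue -/

/-! A mean-square argument suffices, because dimension and assortment size are bounded by constants.
Taking traces in `𝔼[x xᵀ] ⪰ σ₀ I` gives `d σ₀ ≤ 1`, and `K ≤ 18 / κ ^ 4`, so polynomial losses in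
`d` and `K` can be absorbed by the constant.

Only the initialization and rounds within order `log (T N)` of the end of their episode can explore.
The latter number `O(log T * log (T N))`, and each round costs at most `2`. In any other round the
assortment maximizes the revenue for the utilities `z`. For equal revenues the revenue is
1-Lipschitz in the utilities (sup norm), so the regret is at most twice the estimation error plus
the bonus (`optRevenue_sub_revenue_le`). The bonus is counted as an error; optimism is not
exploited. For `r ≤ 0` such a round has no regret.

Both errors are governed by the previous episode. For `r > 0` the maximizer takes the `K` highest
scores, so the diversity constant bounds the conditional expected Gram matrix of each exploitation
round below by `K σ₀ / M`. The deviations from these conditional expectations and the score at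
`θstar` are sums of martingale differences, so their mean squares grow linearly in the number `L` of
rounds (`IsEnvironment.integral_gramDevSq_le`, `IsEnvironment.integral_norm_score_sq_le`), against a
squared signal of order `L ^ 2`. If both are small, strong monotonicity of the score puts the MLE at
distance `O(‖score‖ / L)` from `θstar` (`exists_score_eq_zero`, `norm_sub_le_of_score_eq_zero`) and
the bonus is `O(α / √L)`. Otherwise the trivial bound `2` is charged to the squared deviation.
Integrating gives expected regret `O(√(log (T N) / t))` (`IsDBLMNL.integral_roundRegret_le`).

Summation (`sum_le_of_round_bound`) yields `O(log T * √(T log (T N)))`, and one factor `log T` under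
the root is traded for `d log (T / d)` by `log_le_mul_log_div`. -/

theorem choiceProb_some {N : ℕ} (u : Fin N → ℝ) {S : Finset (Fin N)} {i : Fin N} (hi : i ∈ S) :
    choiceProb u S (some i) = Real.exp (u i) / (1 + ∑ j ∈ S, Real.exp (u j)) := by
  simp [choiceProb, hi]

theorem one_add_sum_exp_pos {N : ℕ} (u : Fin N → ℝ) (S : Finset (Fin N)) :
    0 < 1 + ∑ j ∈ S, Real.exp (u j) := by positivity

theorem choiceProb_nonneg {N : ℕ} (u : Fin N → ℝ) (S : Finset (Fin N)) (a : Option (Fin N)) :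
    0 ≤ choiceProb u S a := by
  cases a with
  | none => simp only [choiceProb]; positivity
  | some i => simp only [choiceProb]; split_ifs <;> positivity

theorem choiceProb_none_add_sum {N : ℕ} (u : Fin N → ℝ) (S : Finset (Fin N)) :
    choiceProb u S none + ∑ i ∈ S, choiceProb u S (some i) = 1 := by
  have h := one_add_sum_exp_pos u S
  rw [Finset.sum_congr rfl fun i hi => choiceProb_some u hi, ← Finset.sum_div]
  simp only [choiceProb]
  rw [← add_div, div_self h.ne']

theorem sum_choiceProb_le_one {N : ℕ} (u : Fin N → ℝ) (S : Finset (Fin N)) :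
    ∑ i ∈ S, choiceProb u S (some i) ≤ 1 := by
  linarith [choiceProb_none_add_sum u S, choiceProb_nonneg u S none]

theorem choiceProb_le_one {N : ℕ} (u : Fin N → ℝ) (S : Finset (Fin N)) (a : Option (Fin N)) :
    choiceProb u S a ≤ 1 := by
  have h := choiceProb_none_add_sum u S
  have h0 := choiceProb_nonneg u S none
  have h1 : 0 ≤ ∑ i ∈ S, choiceProb u S (some i) :=
    Finset.sum_nonneg fun i _ => choiceProb_nonneg u S _
  cases a with
  | none => linarith
  | some i =>
    by_cases hi : i ∈ S
    · have := Finset.single_le_sum (f := fun i => choiceProb u S (some i))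
        (fun i _ => choiceProb_nonneg u S _) hi
      linarith
    · simp [choiceProb, hi]

theorem revenue_const {N : ℕ} (r : ℝ) (u : Fin N → ℝ) (S : Finset (Fin N)) :
    revenue (fun _ => r) u S =
      r * ((∑ j ∈ S, Real.exp (u j)) / (1 + ∑ j ∈ S, Real.exp (u j))) := by
  rw [revenue, ← Finset.mul_sum, Finset.sum_congr rfl fun i hi => choiceProb_some u hi,
    ← Finset.sum_div]

theorem div_one_add_lt {s t : ℝ} (hs : 0 ≤ s) (hst : s < t) : s / (1 + s) < t / (1 + t) := by
  rw [div_lt_div_iff₀ (by linarith) (by linarith)]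
  nlinarith

theorem div_one_add_mem {s : ℝ} (hs : 0 ≤ s) : 0 ≤ s / (1 + s) ∧ s / (1 + s) ≤ 1 :=
  ⟨by positivity, by rw [div_le_one (by linarith)]; linarith⟩

theorem abs_revenue_le_one {N : ℕ} {r : ℝ} (hr : |r| ≤ 1) (u : Fin N → ℝ)
    (S : Finset (Fin N)) : |revenue (fun _ => r) u S| ≤ 1 := by
  have h := div_one_add_mem (s := ∑ j ∈ S, Real.exp (u j)) (by positivity)
  rw [revenue_const, abs_mul, abs_of_nonneg h.1]
  exact mul_le_one₀ hr h.1 h.2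

theorem abs_optRevenue_le_one {N K : ℕ} {r : ℝ} (hr : |r| ≤ 1) (u : Fin N → ℝ) :
    |optRevenue K (fun _ => r) u| ≤ 1 := by
  obtain ⟨A, -, hA⟩ := Finset.exists_mem_eq_sup' (assortments_nonempty N K)
    (revenue (fun _ => r) u)
  rw [optRevenue, hA]
  exact abs_revenue_le_one hr u A

/-- Raising all utilities by `ε` multiplies the total weight `s` by `exp ε`, and `s / (1 + s)` has
derivative at most `1` in `log s`. The Lipschitz constant therefore does not depend on the size of
`S`. -/
theorem sum_exp_div_le_add {N : ℕ} (u z : Fin N → ℝ) (S : Finset (Fin N)) {ε : ℝ} (hε : 0 ≤ ε)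
    (h : ∀ i, u i ≤ z i + ε) :
    (∑ j ∈ S, Real.exp (u j)) / (1 + ∑ j ∈ S, Real.exp (u j)) ≤
      (∑ j ∈ S, Real.exp (z j)) / (1 + ∑ j ∈ S, Real.exp (z j)) + ε := by
  set s := ∑ j ∈ S, Real.exp (z j) with hs
  set E := Real.exp ε with hE
  have hE1 : 1 ≤ E := Real.one_le_exp hε
  have hs0 : 0 ≤ s := by positivity
  have hle : ∑ j ∈ S, Real.exp (u j) ≤ E * s := by
    rw [hs, Finset.mul_sum]
    refine Finset.sum_le_sum fun j _ => ?_
    rw [hE, ← Real.exp_add]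
    exact Real.exp_le_exp.2 (by linarith [h j])
  have hEs : 0 ≤ E * s := by positivity
  have h1 : (∑ j ∈ S, Real.exp (u j)) / (1 + ∑ j ∈ S, Real.exp (u j)) ≤ E * s / (1 + E * s) := by
    rw [div_le_div_iff₀ (one_add_sum_exp_pos u S) (by linarith)]
    nlinarith
  -- This is `1 - ε ≤ exp (-ε)` multiplied by `exp ε`.
  have hEi : E - 1 ≤ ε * E := by
    have h2 : 1 - ε ≤ Real.exp (-ε) := by linarith [Real.add_one_le_exp (-ε)]
    have h3 : Real.exp (-ε) * E = 1 := by rw [hE, ← Real.exp_add]; simp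
    nlinarith
  have h2 : E * s / (1 + E * s) - s / (1 + s) ≤ ε := by
    rw [div_sub_div _ _ (by positivity) (by positivity), div_le_iff₀ (by positivity)]
    have h3 : (E - 1) * s ≤ ε * E * s := mul_le_mul_of_nonneg_right hEi hs0
    have h4 : 0 ≤ ε * (1 + s + E * s * s) := by positivity
    nlinarith
  linarith

theorem abs_revenue_sub_le {N : ℕ} {r : ℝ} (hr : |r| ≤ 1) (u z : Fin N → ℝ)
    (S : Finset (Fin N)) {ε : ℝ} (hε : 0 ≤ ε) (h : ∀ i, |u i - z i| ≤ ε) :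
    |revenue (fun _ => r) u S - revenue (fun _ => r) z S| ≤ ε := by
  have h1 := sum_exp_div_le_add u z S hε fun i => by linarith [(abs_le.1 (h i)).2]
  have h2 := sum_exp_div_le_add z u S hε fun i => by linarith [(abs_le.1 (h i)).1]
  rw [revenue_const, revenue_const, ← mul_sub, abs_mul]
  calc |r| * _ ≤ 1 * ε := by
        refine mul_le_mul hr (abs_le.2 ⟨by linarith, by linarith⟩) (abs_nonneg _) zero_le_one
    _ = ε := one_mul ε

/-- Maximizing the revenue for utilities `z` that are uniformly `ε`-close to `u` loses at most
`2 ε`. -/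
theorem optRevenue_sub_revenue_le {N K : ℕ} {r : ℝ} (hr : |r| ≤ 1)
    {sel : (Fin N → ℝ) → Finset (Fin N)} (hsel : IsArgmaxRule K (fun _ => r) sel)
    (u z : Fin N → ℝ) {ε : ℝ} (hε : 0 ≤ ε) (h : ∀ i, |u i - z i| ≤ ε) :
    optRevenue K (fun _ => r) u - revenue (fun _ => r) u (sel z) ≤ 2 * ε := by
  obtain ⟨A, hA, hA'⟩ := Finset.exists_mem_eq_sup' (assortments_nonempty N K)
    (revenue (fun _ => r) u)
  rw [optRevenue, hA']
  have h1 := (abs_le.1 (abs_revenue_sub_le hr u z A hε h)).2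
  have h2 := (abs_le.1 (abs_revenue_sub_le hr u z (sel z) hε h)).1
  have h3 := hsel.optimal z A hA
  linarith

/-- For `r < 0` the empty assortment is the unique maximizer whatever the utilities are, and for `r
= 0` all revenues vanish. This sign is treated apart because the top-set property below needs `r >
0`. -/
theorem optRevenue_sub_revenue_le_zero {N K : ℕ} {r : ℝ} (hr : r ≤ 0)
    {sel : (Fin N → ℝ) → Finset (Fin N)} (hsel : IsArgmaxRule K (fun _ => r) sel)
    (u z : Fin N → ℝ) :
    optRevenue K (fun _ => r) u - revenue (fun _ => r) u (sel z) ≤ 0 := by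
  have h1 : optRevenue K (fun _ => r) u ≤ 0 := by
    refine Finset.sup'_le _ _ fun A _ => ?_
    rw [revenue_const]
    exact mul_nonpos_of_nonpos_of_nonneg hr (by positivity)
  have h2 := hsel.optimal z ∅ (by simp [assortments])
  rw [revenue_const, revenue_const] at h2
  simp only [Finset.sum_empty, zero_div, mul_zero] at h2
  rw [revenue_const]
  rcases hr.lt_or_eq with hr | rfl
  · rcases (sel z).eq_empty_or_nonempty with he | hne
    · simpa [he] using h1
    · have : 0 < ∑ j ∈ sel z, Real.exp (z j) := Finset.sum_pos (fun _ _ => Real.exp_pos _) hne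
      have h3 : r * ((∑ j ∈ sel z, Real.exp (z j)) / (1 + ∑ j ∈ sel z, Real.exp (z j))) < 0 :=
        mul_neg_of_neg_of_pos hr (by positivity)
      linarith
  · simpa using h1

/-- For `r > 0` the revenue increases strictly with the total weight `∑ exp (z j)`. Adding an item
to a set with fewer than `K` items, or exchanging an item for one with higher utility, would
increase this weight. -/
theorem IsArgmaxRule.isTopSet {N K : ℕ} (hKN : K ≤ N) {r : ℝ} (hr : 0 < r)
    {sel : (Fin N → ℝ) → Finset (Fin N)} (hsel : IsArgmaxRule K (fun _ => r) sel)
    (z : Fin N → ℝ) : IsTopSet K z (sel z) := by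
  have key : ∀ A ∈ assortments N K,
      ∑ j ∈ A, Real.exp (z j) ≤ ∑ j ∈ sel z, Real.exp (z j) := by
    intro A hA
    by_contra! hlt
    have h1 := hsel.optimal z A hA
    rw [revenue_const, revenue_const] at h1
    have h2 := div_one_add_lt (by positivity) hlt
    have h3 := mul_lt_mul_of_pos_left h2 hr
    linarith
  have hcard : (sel z).card ≤ K := by simpa [assortments] using hsel.feasible z
  refine ⟨?_, fun i hi j hj => ?_⟩
  · by_contra hne
    have hlt : (sel z).card < K := lt_of_le_of_ne hcard hne
    obtain ⟨j, hj⟩ : ∃ j, j ∉ sel z := by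
      by_contra! hall
      have : sel z = Finset.univ := Finset.eq_univ_iff_forall.2 hall
      rw [this, Finset.card_univ, Fintype.card_fin] at hlt
      omega
    have h1 := key (insert j (sel z)) (by
      simp only [assortments, Finset.mem_filter, Finset.mem_univ, true_and]
      rw [Finset.card_insert_of_notMem hj]
      omega)
    rw [Finset.sum_insert hj] at h1
    linarith [Real.exp_pos (z j)]
  · by_contra! hlt
    have hj' : j ∉ (sel z).erase i := fun h => hj (Finset.mem_of_mem_erase h)
    have h1 := key (insert j ((sel z).erase i)) (by
      simp only [assortments, Finset.mem_filter, Finset.mem_univ, true_and]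
      rw [Finset.card_insert_of_notMem hj', Finset.card_erase_of_mem hi]
      have := Finset.card_pos.2 ⟨i, hi⟩
      omega)
    rw [Finset.sum_insert hj', ← Finset.add_sum_erase _ _ hi] at h1
    linarith [Real.exp_lt_exp.2 hlt]

/-! ### The maximum likelihood estimate -/

/-- Negative log-likelihood of the choices in the rounds of `I`. -/
def negLogLik {N d : ℕ} (x : ℕ → Fin N → Vec d) (S : ℕ → Finset (Fin N))
    (c : ℕ → Option (Fin N)) (I : Finset ℕ) (θ : Vec d) : ℝ :=
  ∑ t ∈ I, (Real.log (1 + ∑ j ∈ S t, Real.exp (utility (x t) θ j)) -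
    ∑ i ∈ S t, (if c t = some i then 1 else 0) * utility (x t) θ i)

section MLE

variable {N d : ℕ} (x : ℕ → Fin N → Vec d) (S : ℕ → Finset (Fin N))
  (c : ℕ → Option (Fin N)) (I : Finset ℕ)

theorem inner_score (θ v : Vec d) :
    inner ℝ (score x S c I θ) v = ∑ t ∈ I, ∑ i ∈ S t,
      (choiceProb (utility (x t) θ) (S t) (some i) - (if c t = some i then 1 else 0)) *
        utility (x t) v i := by
  simp only [score, sum_inner, real_inner_smul_left, utility]

theorem utility_add_smul (X : Fin N → Vec d) (θ v : Vec d) (s : ℝ) (i : Fin N) :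
    utility X (θ + s • v) i = utility X θ i + s * utility X v i := by
  simp [utility, inner_add_right, real_inner_smul_right]

theorem hasDerivAt_utility (X : Fin N → Vec d) (θ v : Vec d) (s : ℝ) (i : Fin N) :
    HasDerivAt (fun s : ℝ => utility X (θ + s • v) i) (utility X v i) s := by
  simp only [utility_add_smul]
  simpa using ((hasDerivAt_id s).mul_const (utility X v i)).const_add (utility X θ i)

theorem hasDerivAt_sum_exp (X : Fin N → Vec d) (A : Finset (Fin N)) (θ v : Vec d) (s : ℝ) :
    HasDerivAt (fun s : ℝ => 1 + ∑ j ∈ A, Real.exp (utility X (θ + s • v) j))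
      (∑ j ∈ A, Real.exp (utility X (θ + s • v) j) * utility X v j) s :=
  (HasDerivAt.fun_sum fun j _ => (hasDerivAt_utility X θ v s j).exp).const_add 1

theorem hasDerivAt_negLogLik (θ v : Vec d) (s : ℝ) :
    HasDerivAt (fun s : ℝ => negLogLik x S c I (θ + s • v))
      (inner ℝ (score x S c I (θ + s • v)) v) s := by
  rw [inner_score]
  unfold negLogLik
  refine HasDerivAt.fun_sum fun t _ => ?_
  have h1 := (hasDerivAt_sum_exp (x t) (S t) θ v s).log (one_add_sum_exp_pos _ _).ne'
  have h2 : HasDerivAt (fun s : ℝ => ∑ i ∈ S t,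
      (if c t = some i then (1 : ℝ) else 0) * utility (x t) (θ + s • v) i)
      (∑ i ∈ S t, (if c t = some i then (1 : ℝ) else 0) * utility (x t) v i) s :=
    HasDerivAt.fun_sum fun i _ => (hasDerivAt_utility (x t) θ v s i).const_mul _
  refine (h1.sub h2).congr_deriv ?_
  rw [Finset.sum_div, ← Finset.sum_sub_distrib]
  refine Finset.sum_congr rfl fun i hi => ?_
  rw [choiceProb_some _ hi]
  ring

theorem continuous_negLogLik : Continuous (negLogLik x S c I) := by
  unfold negLogLik
  refine continuous_finsetSum _ fun t _ => Continuous.sub (Continuous.log ?_ ?_) ?_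
  · unfold utility; fun_prop
  · exact fun θ => (one_add_sum_exp_pos _ _).ne'
  · unfold utility; fun_prop

/-- Variance of the numbers `a i` under the choice probabilities. -/
def choiceVar (u a : Fin N → ℝ) (A : Finset (Fin N)) : ℝ :=
  ∑ i ∈ A, choiceProb u A (some i) * a i ^ 2 - (∑ i ∈ A, choiceProb u A (some i) * a i) ^ 2

theorem hasDerivAt_inner_score (θ v : Vec d) (s : ℝ) :
    HasDerivAt (fun s : ℝ => inner ℝ (score x S c I (θ + s • v)) v)
      (∑ t ∈ I, choiceVar (utility (x t) (θ + s • v)) (utility (x t) v) (S t)) s := by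
  simp only [inner_score]
  refine HasDerivAt.fun_sum fun t _ => ?_
  have hp := one_add_sum_exp_pos (utility (x t) (θ + s • v)) (S t)
  have h : ∀ i ∈ S t, HasDerivAt (fun s : ℝ =>
      (choiceProb (utility (x t) (θ + s • v)) (S t) (some i) - (if c t = some i then 1 else 0)) *
        utility (x t) v i)
      (choiceProb (utility (x t) (θ + s • v)) (S t) (some i) * utility (x t) v i ^ 2 -
        choiceProb (utility (x t) (θ + s • v)) (S t) (some i) * utility (x t) v i *
        ∑ j ∈ S t, choiceProb (utility (x t) (θ + s • v)) (S t) (some j) * utility (x t) v j)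
      s := by
    intro i hi
    have h1 := ((hasDerivAt_utility (x t) θ v s i).exp.div
      (hasDerivAt_sum_exp (x t) (S t) θ v s) hp.ne')
    have h2 := (h1.sub_const (if c t = some i then (1 : ℝ) else 0)).mul_const (utility (x t) v i)
    simp only [choiceProb_some _ hi]
    refine h2.congr_deriv ?_
    have hsum : ∑ j ∈ S t, choiceProb (utility (x t) (θ + s • v)) (S t) (some j) *
        utility (x t) v j = (∑ j ∈ S t, Real.exp (utility (x t) (θ + s • v) j) *
          utility (x t) v j) / (1 + ∑ j ∈ S t, Real.exp (utility (x t) (θ + s • v) j)) := by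
      rw [Finset.sum_div]
      exact Finset.sum_congr rfl fun j hj => by rw [choiceProb_some _ hj, div_mul_eq_mul_div]
    rw [hsum]
    generalize (∑ j ∈ S t, Real.exp (utility (x t) (θ + s • v) j) * utility (x t) v j) = a
    generalize 1 + ∑ j ∈ S t, Real.exp (utility (x t) (θ + s • v) j) = b at hp
    field_simp
  refine (HasDerivAt.fun_sum h).congr_deriv ?_
  rw [choiceVar, Finset.sum_sub_distrib, ← Finset.sum_mul, sq]

/-- Cauchy–Schwarz gives `(∑ p a)² ≤ (∑ p) (∑ p a²)`, and `∑ p` is one minus the probability of the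
outside option. The products `p(i) p(0)` bounded below by `κ` thus appear as curvature of the
likelihood. -/
theorem choiceProb_none_mul_le_choiceVar (u a : Fin N → ℝ) (A : Finset (Fin N)) :
    ∑ i ∈ A, choiceProb u A (some i) * choiceProb u A none * a i ^ 2 ≤ choiceVar u a A := by
  have hcs : (∑ i ∈ A, choiceProb u A (some i) * a i) ^ 2 ≤
      (∑ i ∈ A, choiceProb u A (some i)) * ∑ i ∈ A, choiceProb u A (some i) * a i ^ 2 := by
    refine Finset.sum_sq_le_sum_mul_sum_of_sq_le_mul _ (fun i _ => choiceProb_nonneg u A _)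
      (fun i _ => mul_nonneg (choiceProb_nonneg u A _) (sq_nonneg _)) fun i _ => le_of_eq (by ring)
  have h1 := choiceProb_none_add_sum u A
  have h2 : ∑ i ∈ A, choiceProb u A (some i) * choiceProb u A none * a i ^ 2 =
      choiceProb u A none * ∑ i ∈ A, choiceProb u A (some i) * a i ^ 2 := by
    rw [Finset.mul_sum]
    exact Finset.sum_congr rfl fun i _ => by ring
  rw [h2, choiceVar, show choiceProb u A none = 1 - ∑ i ∈ A, choiceProb u A (some i) by linarith]
  linarith

theorem choiceVar_nonneg (u a : Fin N → ℝ) (A : Finset (Fin N)) : 0 ≤ choiceVar u a A :=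
  (Finset.sum_nonneg fun _ _ => mul_nonneg
    (mul_nonneg (choiceProb_nonneg u A _) (choiceProb_nonneg u A _)) (sq_nonneg _)).trans
    (choiceProb_none_mul_le_choiceVar u a A)

theorem monotone_inner_score (θ v : Vec d) :
    Monotone fun s : ℝ => inner ℝ (score x S c I (θ + s • v)) v :=
  monotone_of_hasDerivAt_nonneg (hasDerivAt_inner_score x S c I θ v) fun _ =>
    Finset.sum_nonneg fun _ _ => choiceVar_nonneg _ _ _

variable {x S I} {J : Finset ℕ} {κ lam : ℝ} {θ₀ : Vec d}

/-- Strong monotonicity of the score on the unit ball around `θ₀`. -/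
theorem inner_score_add_ge (hκ : 0 < κ) (hJ : J ⊆ I)
    (hbound : ∀ t ∈ J, ∀ i ∈ S t, ∀ θ : Vec d, ‖θ - θ₀‖ ≤ 1 →
      κ ≤ choiceProb (utility (x t) θ) (S t) (some i) *
        choiceProb (utility (x t) θ) (S t) none)
    (hgram : ∀ v : Vec d, lam * ‖v‖ ^ 2 ≤ ∑ t ∈ J, ∑ i ∈ S t, utility (x t) v i ^ 2)
    (v : Vec d) (hv : ‖v‖ ≤ 1) :
    inner ℝ (score x S c I θ₀) v + κ * lam * ‖v‖ ^ 2 ≤ inner ℝ (score x S c I (θ₀ + v)) v := by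
  have hd := hasDerivAt_inner_score x S c I θ₀ v
  -- Mean value inequality on `[0, 1]`: the derivative along the segment is a sum of variances.
  -- Those of the rounds in `J` are bounded below through `κ` and the Gram matrix; the other rounds
  -- of `I` contribute nonnegatively.
  have hmvt := Convex.mul_sub_le_image_sub_of_le_deriv (convex_Icc (0 : ℝ) 1)
    (f := fun s : ℝ => inner ℝ (score x S c I (θ₀ + s • v)) v)
    (C := κ * lam * ‖v‖ ^ 2)
    (fun s _ => (hd s).continuousAt.continuousWithinAt)
    (fun s _ => (hd s).differentiableAt.differentiableWithinAt)
    (fun s hs => ?_) 0 (by simp) 1 (by simp) zero_le_one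
  · simp only [sub_zero, mul_one, one_smul, zero_smul, add_zero] at hmvt
    linarith
  · rw [interior_Icc] at hs
    rw [(hd s).deriv, mul_assoc]
    calc κ * (lam * ‖v‖ ^ 2) ≤ κ * ∑ t ∈ J, ∑ i ∈ S t, utility (x t) v i ^ 2 :=
          mul_le_mul_of_nonneg_left (hgram v) hκ.le
      _ = ∑ t ∈ J, ∑ i ∈ S t, κ * utility (x t) v i ^ 2 := by simp only [Finset.mul_sum]
      _ ≤ ∑ t ∈ J, choiceVar (utility (x t) (θ₀ + s • v)) (utility (x t) v) (S t) := by
          refine Finset.sum_le_sum fun t ht =>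
            le_trans (Finset.sum_le_sum fun i hi => ?_) (choiceProb_none_mul_le_choiceVar _ _ _)
          refine mul_le_mul_of_nonneg_right (hbound t ht i hi _ ?_) (sq_nonneg _)
          rw [add_sub_cancel_left, norm_smul, Real.norm_of_nonneg hs.1.le]
          exact mul_le_one₀ hs.2.le (norm_nonneg _) hv
      _ ≤ _ := Finset.sum_le_sum_of_subset_of_nonneg hJ fun _ _ _ => choiceVar_nonneg _ _ _

/-- On the unit sphere around `θ₀` the curvature beats the score at the center, so the negative
log-likelihood increases outwards there. This both excludes distant zeros of the score and keeps the
minimizer off the boundary. -/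
theorem inner_score_add_pos (hκ : 0 < κ) (hJ : J ⊆ I)
    (hbound : ∀ t ∈ J, ∀ i ∈ S t, ∀ θ : Vec d, ‖θ - θ₀‖ ≤ 1 →
      κ ≤ choiceProb (utility (x t) θ) (S t) (some i) *
        choiceProb (utility (x t) θ) (S t) none)
    (hgram : ∀ v : Vec d, lam * ‖v‖ ^ 2 ≤ ∑ t ∈ J, ∑ i ∈ S t, utility (x t) v i ^ 2)
    (hZ : ‖score x S c I θ₀‖ < κ * lam) (v : Vec d) (hv : ‖v‖ = 1) :
    0 < inner ℝ (score x S c I (θ₀ + v)) v := by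
  have h1 := inner_score_add_ge c hκ hJ hbound hgram v hv.le
  have h2 := (abs_le.1 (abs_real_inner_le_norm (score x S c I θ₀) v)).1
  rw [hv] at h1 h2
  linarith

/-- If the Gram matrix is large compared with the score at `θ₀`, every zero of the score is close
to `θ₀`. -/
theorem norm_sub_le_of_score_eq_zero (hκ : 0 < κ) (hlam : 0 < lam) (hJ : J ⊆ I)
    (hbound : ∀ t ∈ J, ∀ i ∈ S t, ∀ θ : Vec d, ‖θ - θ₀‖ ≤ 1 →
      κ ≤ choiceProb (utility (x t) θ) (S t) (some i) *
        choiceProb (utility (x t) θ) (S t) none)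
    (hgram : ∀ v : Vec d, lam * ‖v‖ ^ 2 ≤ ∑ t ∈ J, ∑ i ∈ S t, utility (x t) v i ^ 2)
    (hZ : ‖score x S c I θ₀‖ < κ * lam) {θ : Vec d} (hθ : score x S c I θ = 0) :
    ‖θ - θ₀‖ ≤ ‖score x S c I θ₀‖ / (κ * lam) := by
  set w := θ - θ₀ with hw
  have hθw : θ = θ₀ + w := by rw [hw]; abel
  have hkl : 0 < κ * lam := mul_pos hκ hlam
  rcases le_or_gt ‖w‖ 1 with h1 | h1
  · have h := inner_score_add_ge c hκ hJ hbound hgram w h1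
    rw [← hθw, hθ, inner_zero_left] at h
    have h2 := (abs_le.1 (abs_real_inner_le_norm (score x S c I θ₀) w)).1
    rcases (norm_nonneg w).eq_or_lt with h0 | h0
    · rw [← h0]; positivity
    · rw [le_div_iff₀ hkl]
      nlinarith
  -- A zero outside the unit ball is impossible: along the ray through `w` the directional score is
  -- nondecreasing and already positive on the unit sphere.
  · exfalso
    have hw0 : 0 < ‖w‖ := by linarith
    have hv : ‖(‖w‖⁻¹ : ℝ) • w‖ = 1 := by
      rw [norm_smul, norm_inv, norm_norm, inv_mul_cancel₀ hw0.ne']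
    have h2 := inner_score_add_pos c hκ hJ hbound hgram hZ _ hv
    have h3 := monotone_inner_score x S c I θ₀ ((‖w‖⁻¹ : ℝ) • w) h1.le
    have h4 : ‖w‖ • (‖w‖⁻¹ : ℝ) • w = w := by rw [smul_smul, mul_inv_cancel₀ hw0.ne', one_smul]
    simp only [one_smul, h4] at h3
    rw [← hθw, hθ, inner_zero_left] at h3
    linarith

/-- If the Gram matrix is large compared with the score at `θ₀`, the score has a zero. -/
theorem exists_score_eq_zero (hκ : 0 < κ) (hJ : J ⊆ I)
    (hbound : ∀ t ∈ J, ∀ i ∈ S t, ∀ θ : Vec d, ‖θ - θ₀‖ ≤ 1 →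
      κ ≤ choiceProb (utility (x t) θ) (S t) (some i) *
        choiceProb (utility (x t) θ) (S t) none)
    (hgram : ∀ v : Vec d, lam * ‖v‖ ^ 2 ≤ ∑ t ∈ J, ∑ i ∈ S t, utility (x t) v i ^ 2)
    (hZ : ‖score x S c I θ₀‖ < κ * lam) : ∃ θ, score x S c I θ = 0 := by
  -- Minimize the negative log-likelihood over the compact unit ball; an interior minimizer is a
  -- zero of its gradient, the score.
  obtain ⟨θ, hθ, hmin⟩ := (isCompact_closedBall θ₀ (1 : ℝ)).exists_isMinOn
    ⟨θ₀, by simp⟩ (continuous_negLogLik x S c I).continuousOn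
  rw [mem_closedBall_iff_norm] at hθ
  rcases hθ.lt_or_eq with hlt | heq
  · refine ⟨θ, ?_⟩
    have hloc : IsLocalMin (negLogLik x S c I) θ := by
      refine hmin.isLocalMin (Metric.closedBall_mem_nhds_of_mem ?_)
      rwa [mem_ball_iff_norm]
    -- Differentiating in the direction of the score itself gives its squared norm.
    rw [← inner_self_eq_zero (𝕜 := ℝ)]
    have hd := hasDerivAt_negLogLik x S c I θ (score x S c I θ) 0
    simp only [zero_smul, add_zero] at hd
    refine IsLocalMin.hasDerivAt_eq_zero (IsLocalMin.comp_continuous (f := negLogLik x S c I)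
      (g := fun s : ℝ => θ + s • score x S c I θ) (b := 0) ?_ ?_) hd
    · simpa using hloc
    · fun_prop
  · exfalso
    set v := θ - θ₀ with hv
    have hθv : θ = θ₀ + v := by rw [hv]; abel
    have hpos := inner_score_add_pos c hκ hJ hbound hgram hZ v heq
    have hd := hasDerivAt_negLogLik x S c I θ₀ v 1
    rw [one_smul] at hd
    -- At a boundary minimizer all difference quotients from inside the ball are nonpositive,
    -- against the positive radial derivative.
    have : inner ℝ (score x S c I (θ₀ + v)) v ≤ 0 := by
      have hslope := hd.tendsto_slope.mono_left (nhdsWithin_mono 1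
        (s := Set.Iio 1) fun y (hy : y < 1) => hy.ne)
      refine le_of_tendsto hslope ?_
      filter_upwards [Ioo_mem_nhdsLT (zero_lt_one (α := ℝ))] with s hs
      rw [slope_def_field, one_smul, ← hθv]
      refine div_nonpos_of_nonneg_of_nonpos (sub_nonneg.2 (hmin ?_)) (by linarith [hs.2])
      rw [mem_closedBall_iff_norm, add_sub_cancel_left, norm_smul, heq, mul_one,
        Real.norm_of_nonneg hs.1.le]
      exact hs.2.le
    linarith

end MLE

/-! ### Measurability and quadratic forms -/

/-- Random assortments and choices are handled through their level sets: the domain is cut into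
finitely many measurable pieces, on each of which the index is constant. -/
theorem measurable_comp_of_finite {α ι β : Type*} [Finite ι] {m : MeasurableSpace α}
    [MeasurableSpace β] {s : α → ι} (hs : ∀ i, MeasurableSet (s ⁻¹' {i})) {f : ι → α → β}
    (hf : ∀ i, Measurable (f i)) : Measurable fun a => f (s a) a := by
  intro B hB
  have : (fun a => f (s a) a) ⁻¹' B = ⋃ i, s ⁻¹' {i} ∩ f i ⁻¹' B := by
    ext a
    simp
  rw [this]
  exact MeasurableSet.iUnion fun i => (hs i).inter (hf i hB)

theorem measurable_utility {N d : ℕ} (θ : Vec d) (i : Fin N) :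
    Measurable fun X : Fin N → Vec d => utility X θ i := by
  unfold utility
  fun_prop

theorem utility_sq_le {N d : ℕ} {X : Fin N → Vec d} (hX : ∀ i, ‖X i‖ ≤ 1) (v : Vec d)
    (i : Fin N) : utility X v i ^ 2 ≤ ‖v‖ ^ 2 := by
  rw [← sq_abs]
  refine pow_le_pow_left₀ (abs_nonneg _) ((abs_real_inner_le_norm (X i) v).trans ?_) 2
  exact (mul_le_mul_of_nonneg_right (hX i) (norm_nonneg v)).trans_eq (one_mul _)

theorem abs_apply_le {d : ℕ} {y : Vec d} (hy : ‖y‖ ≤ 1) (a : Fin d) : |y a| ≤ 1 :=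
  (PiLp.norm_apply_le y a).trans hy

theorem abs_apply_mul_apply_le {d : ℕ} {y : Vec d} (hy : ‖y‖ ≤ 1) (a b : Fin d) :
    |y a * y b| ≤ 1 := by
  rw [abs_mul]
  exact mul_le_one₀ (abs_apply_le hy a) (abs_nonneg _) (abs_apply_le hy b)

theorem dotProduct_mulVec_eq_sum {d : ℕ} (A : Matrix (Fin d) (Fin d) ℝ) (v : Fin d → ℝ) :
    v ⬝ᵥ A.mulVec v = ∑ a, ∑ b, v a * v b * A a b := by
  simp only [dotProduct, Matrix.mulVec, Finset.mul_sum]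
  exact Finset.sum_congr rfl fun a _ => Finset.sum_congr rfl fun b _ => by ring

theorem inner_eq_sum {d : ℕ} (y v : Vec d) : inner ℝ y v = ∑ a, v a * y a := by
  simp [PiLp.inner_apply]

theorem sum_sum_mul_eq_inner_sq {d : ℕ} (y v : Vec d) :
    ∑ a, ∑ b, v a * v b * (y a * y b) = inner ℝ y v ^ 2 := by
  rw [inner_eq_sum, sq, Finset.sum_mul_sum]
  exact Finset.sum_congr rfl fun a _ => Finset.sum_congr rfl fun b _ => by ring

theorem gram_apply {N d : ℕ} (x : ℕ → Fin N → Vec d) (S : ℕ → Finset (Fin N)) (I : Finset ℕ)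
    (a b : Fin d) : gram x S I a b = ∑ t ∈ I, ∑ i ∈ S t, x t i a * x t i b := by
  simp [gram, Matrix.sum_apply, Matrix.vecMulVec_apply]

theorem sum_sum_sum_utility {N d : ℕ} (X : Fin N → Vec d) (A : Finset (Fin N)) (v : Vec d) :
    ∑ a, ∑ b, v a * v b * ∑ i ∈ A, X i a * X i b = ∑ i ∈ A, utility X v i ^ 2 := by
  simp only [utility, ← sum_sum_mul_eq_inner_sq, Finset.mul_sum]
  rw [Finset.sum_comm]
  rw [Finset.sum_congr rfl fun a _ => Finset.sum_comm]
  rw [Finset.sum_comm]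
  conv_rhs => rw [Finset.sum_congr rfl fun a _ => Finset.sum_comm]

theorem dotProduct_gram_mulVec {N d : ℕ} (x : ℕ → Fin N → Vec d) (S : ℕ → Finset (Fin N))
    (I : Finset ℕ) (v : Vec d) :
    v.ofLp ⬝ᵥ (gram x S I).mulVec v.ofLp = ∑ t ∈ I, ∑ i ∈ S t, utility (x t) v i ^ 2 := by
  simp only [dotProduct_mulVec_eq_sum, gram_apply, ← sum_sum_sum_utility]
  simp only [Finset.mul_sum (s := I)]
  rw [Finset.sum_congr rfl fun a _ => Finset.sum_comm]
  rw [Finset.sum_comm]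

theorem isHermitian_gram {N d : ℕ} (x : ℕ → Fin N → Vec d) (S : ℕ → Finset (Fin N))
    (I : Finset ℕ) : (gram x S I).IsHermitian := by
  ext a b
  simp only [Matrix.conjTranspose_apply, gram_apply, star_trivial, mul_comm]

theorem posSemidef_gram {N d : ℕ} (x : ℕ → Fin N → Vec d) (S : ℕ → Finset (Fin N))
    (I : Finset ℕ) : (gram x S I).PosSemidef := by
  refine Matrix.PosSemidef.of_dotProduct_mulVec_nonneg (isHermitian_gram x S I) fun v => ?_
  have h := dotProduct_gram_mulVec x S I (WithLp.toLp 2 v)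
  simp only [star_trivial]
  rw [h]
  positivity

/-- A lower bound on the Gram matrix turns into an upper bound on the weighted norm. -/
theorem weightedNorm_inv_le {d : ℕ} {W : Matrix (Fin d) (Fin d) ℝ} (hW : W.IsHermitian) {lam : ℝ}
    (hlam : 0 < lam) (h : ∀ v : Vec d, lam * ‖v‖ ^ 2 ≤ v.ofLp ⬝ᵥ W.mulVec v.ofLp) {y : Vec d}
    (hy : ‖y‖ ≤ 1) : weightedNorm W⁻¹ y ≤ 1 / Real.sqrt lam := by
  have hpd : W.PosDef := by
    refine Matrix.PosDef.of_dotProduct_mulVec_pos hW fun {v} hv => ?_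
    have h1 := h (WithLp.toLp 2 v)
    have h2 : 0 < ‖(WithLp.toLp 2 v : Vec d)‖ := by
      rw [norm_pos_iff]
      intro h0
      exact hv (by simpa using congrArg WithLp.ofLp h0)
    simp only [star_trivial]
    refine lt_of_lt_of_le ?_ h1
    positivity
  have hdet : IsUnit W.det := (Matrix.isUnit_iff_isUnit_det W).1 hpd.isUnit
  -- Testing the lower bound on `W` at `z = W⁻¹ y` gives `lam ‖z‖² ≤ ⟪y, z⟫ ≤ ‖z‖`. Hence `‖z‖ ≤ 1 /
  -- lam`, and the squared weighted norm `⟪y, z⟫` is at most `1 / lam`.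
  set z : Vec d := WithLp.toLp 2 (W⁻¹.mulVec y.ofLp) with hz
  have hWz : W.mulVec z.ofLp = y.ofLp := by
    rw [hz, Matrix.mulVec_mulVec, Matrix.mul_nonsing_inv _ hdet, Matrix.one_mulVec]
  have h1 := h z
  rw [hWz] at h1
  have h2 : z.ofLp ⬝ᵥ y.ofLp = inner ℝ y z := by
    rw [inner_eq_sum]; rfl
  have h3 : y.ofLp ⬝ᵥ W⁻¹.mulVec y.ofLp = inner ℝ y z := by rw [← h2, dotProduct_comm]
  have h4 := real_inner_le_norm y z
  rw [weightedNorm, h3, ← Real.sqrt_one, ← Real.sqrt_div zero_le_one]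
  refine Real.sqrt_le_sqrt ?_
  rw [h2] at h1
  rw [le_div_iff₀ hlam]
  have hz0 := norm_nonneg z
  have h5 : inner ℝ y z ≤ ‖z‖ := by nlinarith [norm_nonneg y]
  have h6 : lam * ‖z‖ ^ 2 ≤ ‖z‖ := h1.trans h5
  have h7 : ‖z‖ * lam ≤ 1 := by
    rcases hz0.eq_or_lt with h0 | h0
    · rw [← h0]; simp
    · by_contra! hlt
      nlinarith
  nlinarith

/-- Absorbing the confidence radius into the matrix brings the optimistic utilities into the form
required by `DiversityConstant`. -/
theorem mul_weightedNorm {d : ℕ} {a : ℝ} (ha : 0 ≤ a) (V : Matrix (Fin d) (Fin d) ℝ) (y : Vec d) :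
    a * weightedNorm V y = weightedNorm (a ^ 2 • V) y := by
  rw [weightedNorm, weightedNorm, Matrix.smul_mulVec, dotProduct_smul, smul_eq_mul,
    Real.sqrt_mul (sq_nonneg a), Real.sqrt_sq ha]

/-! ### The context distribution -/

section Contexts

variable {N d : ℕ} {p : Measure (Vec d)} [IsProbabilityMeasure p] {σ₀ : ℝ}

theorem BoundedContexts.ae_pi (hp : BoundedContexts p σ₀) :
    ∀ᵐ X ∂(Measure.pi fun _ : Fin N => p), ∀ i, ‖X i‖ ≤ 1 :=
  ae_all_iff.2 fun i =>
    (Measure.tendsto_eval_ae_ae (μ := fun _ : Fin N => p) (i := i)).eventually hp.norm_le_one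

theorem integrable_apply_mul_apply (hp : BoundedContexts p σ₀) (a b : Fin d) :
    Integrable (fun y : Vec d => y a * y b) p := by
  refine Integrable.of_bound (Measurable.aestronglyMeasurable (by fun_prop)) 1 ?_
  filter_upwards [hp.norm_le_one] with y hy
  exact abs_apply_mul_apply_le hy a b

theorem dotProduct_secondMoment_mulVec (hp : BoundedContexts p σ₀) (v : Vec d) :
    v.ofLp ⬝ᵥ (secondMoment p).mulVec v.ofLp = ∫ y, inner ℝ y v ^ 2 ∂p := by
  simp only [dotProduct_mulVec_eq_sum, secondMoment, Matrix.of_apply, ← sum_sum_mul_eq_inner_sq,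
    ← integral_const_mul]
  rw [integral_finsetSum _ fun a _ => integrable_finsetSum _ fun b _ =>
    (integrable_apply_mul_apply hp a b).const_mul _]
  refine Finset.sum_congr rfl fun a _ => ?_
  rw [integral_finsetSum _ fun b _ => (integrable_apply_mul_apply hp a b).const_mul _]

theorem mul_norm_sq_le_integral (hp : BoundedContexts p σ₀) (v : Vec d) :
    σ₀ * ‖v‖ ^ 2 ≤ ∫ y, inner ℝ y v ^ 2 ∂p := by
  have h := hp.secondMoment_ge.dotProduct_mulVec_nonneg v.ofLp
  rw [star_trivial, Matrix.sub_mulVec, dotProduct_sub, dotProduct_secondMoment_mulVec hp,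
    Matrix.smul_mulVec, Matrix.one_mulVec, dotProduct_smul, smul_eq_mul] at h
  have h2 : v.ofLp ⬝ᵥ v.ofLp = ‖v‖ ^ 2 := by
    rw [EuclideanSpace.real_norm_sq_eq]
    simp [dotProduct, sq]
  rw [h2] at h
  linarith

/-- The trace of the second moment matrix is `𝔼 ‖x‖² ≤ 1`, while each diagonal entry is at least
`σ₀`. The dimension is thereby bounded by `1 / σ₀`. -/
theorem BoundedContexts.dim_mul_le_one (hp : BoundedContexts p σ₀) : d * σ₀ ≤ 1 := by
  have h1 : ∀ a : Fin d, σ₀ ≤ ∫ y : Vec d, y a * y a ∂p := by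
    intro a
    have h := mul_norm_sq_le_integral hp (EuclideanSpace.single a (1 : ℝ))
    simpa [sq, EuclideanSpace.inner_single_right] using h
  calc (d : ℝ) * σ₀ = ∑ _a : Fin d, σ₀ := by simp
    _ ≤ ∑ a : Fin d, ∫ y : Vec d, y a * y a ∂p := Finset.sum_le_sum fun a _ => h1 a
    _ = ∫ y : Vec d, ∑ a, y a * y a ∂p := by
        rw [integral_finsetSum _ fun a _ => integrable_apply_mul_apply hp a a]
    _ ≤ ∫ _y : Vec d, (1 : ℝ) ∂p := by
        refine integral_mono_ae (integrable_finsetSum _ fun a _ =>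
          integrable_apply_mul_apply hp a a) (integrable_const _) ?_
        filter_upwards [hp.norm_le_one] with y hy
        have : ‖y‖ ^ 2 = ∑ a, y a * y a := by
          rw [EuclideanSpace.real_norm_sq_eq]
          simp [sq]
        simp only [← this]
        exact pow_le_one₀ (norm_nonneg y) hy
    _ = 1 := by simp

theorem measurable_sum_pick {pick : (Fin N → Vec d) → Finset (Fin N)}
    (hpick : ∀ B, MeasurableSet (pick ⁻¹' {B})) {f : Fin N → (Fin N → Vec d) → ℝ}
    (hf : ∀ i, Measurable (f i)) : Measurable fun X => ∑ i ∈ pick X, f i X :=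
  measurable_comp_of_finite hpick (f := fun A X => ∑ i ∈ A, f i X) fun A =>
    Finset.measurable_fun_sum A fun i _ => hf i

theorem abs_sum_le_card {ι : Type*} {A : Finset ι} {f : ι → ℝ} (hf : ∀ i, |f i| ≤ 1) :
    |∑ i ∈ A, f i| ≤ A.card := by
  refine (Finset.abs_sum_le_sum_abs _ _).trans ?_
  simpa using Finset.sum_le_card_nsmul A (fun i => |f i|) 1 fun i _ => hf i

theorem integrable_sum_pick (hp : BoundedContexts p σ₀)
    {pick : (Fin N → Vec d) → Finset (Fin N)}
    (hpick : ∀ B, MeasurableSet (pick ⁻¹' {B})) (a b : Fin d) :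
    Integrable (fun X => ∑ i ∈ pick X, X i a * X i b) (Measure.pi fun _ : Fin N => p) := by
  refine Integrable.of_bound (Measurable.aestronglyMeasurable
    (measurable_sum_pick hpick fun i => by fun_prop)) N ?_
  filter_upwards [hp.ae_pi] with X hX
  refine (abs_sum_le_card fun i => abs_apply_mul_apply_le (hX i) a b).trans ?_
  exact_mod_cast (Finset.card_le_univ _).trans_eq (Fintype.card_fin N)

theorem dotProduct_expectedGram_mulVec (hp : BoundedContexts p σ₀)
    {pick : (Fin N → Vec d) → Finset (Fin N)}
    (hpick : ∀ B, MeasurableSet (pick ⁻¹' {B})) (v : Vec d) :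
    v.ofLp ⬝ᵥ (expectedGram p pick).mulVec v.ofLp =
      ∫ X, ∑ i ∈ pick X, utility X v i ^ 2 ∂(Measure.pi fun _ : Fin N => p) := by
  simp only [dotProduct_mulVec_eq_sum, expectedGram, Matrix.of_apply, ← sum_sum_sum_utility,
    ← integral_const_mul]
  rw [integral_finsetSum _ fun a _ => integrable_finsetSum _ fun b _ =>
    (integrable_sum_pick hp hpick a b).const_mul _]
  refine Finset.sum_congr rfl fun a _ => ?_
  rw [integral_finsetSum _ fun b _ => (integrable_sum_pick hp hpick a b).const_mul _]

/-- The expected Gram matrix of the top items is bounded from below, up to a factor that is at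
least a diversity constant. -/
theorem DiversityConstant.mul_norm_sq_le {K : ℕ} {M M' : ℝ} (hM : DiversityConstant N K p M)
    (hMM' : M ≤ M') (hp : BoundedContexts p σ₀) (θ : Vec d) {A : Matrix (Fin d) (Fin d) ℝ}
    (hA : A.PosSemidef) {pick : (Fin N → Vec d) → Finset (Fin N)}
    (hpick : ∀ B, MeasurableSet (pick ⁻¹' {B}))
    (htop : ∀ X, IsTopSet K (fun i => inner ℝ (X i) θ + weightedNorm A (X i)) (pick X))
    (v : Vec d) :
    K * σ₀ * ‖v‖ ^ 2 ≤ M' * (v.ofLp ⬝ᵥ (expectedGram p pick).mulVec v.ofLp) := by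
  have h := (hM θ A hA pick hpick htop).dotProduct_mulVec_nonneg v.ofLp
  rw [star_trivial, Matrix.sub_mulVec, dotProduct_sub, Matrix.smul_mulVec, dotProduct_smul,
    Matrix.smul_mulVec, dotProduct_smul, dotProduct_secondMoment_mulVec hp, smul_eq_mul,
    smul_eq_mul] at h
  -- Nonnegativity of this form is what allows `M` to be replaced by the larger `M'`.
  have h1 : 0 ≤ v.ofLp ⬝ᵥ (expectedGram p pick).mulVec v.ofLp := by
    rw [dotProduct_expectedGram_mulVec hp hpick]
    exact integral_nonneg fun X => Finset.sum_nonneg fun i _ => sq_nonneg _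
  have h2 := mul_le_mul_of_nonneg_left (mul_norm_sq_le_integral hp v) (Nat.cast_nonneg' K)
  have h3 := mul_le_mul_of_nonneg_right hMM' h1
  linarith

/-! ### Existence of a diversity constant -/

theorem isHermitian_of_symm {d : ℕ} {A : Matrix (Fin d) (Fin d) ℝ}
    (h : ∀ a b, A a b = A b a) : A.IsHermitian := by
  ext a b
  simp [h b a]

/-- With probability at least `σ₀ / 2` a context has a large component in a given direction. -/
theorem half_le_measure_inner_sq (hσ₀ : 0 < σ₀) (hp : BoundedContexts p σ₀) {v : Vec d}
    (hv : ‖v‖ = 1) : σ₀ / 2 ≤ p.real {y | σ₀ / 2 ≤ inner ℝ y v ^ 2} := by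
  have hE : MeasurableSet {y : Vec d | σ₀ / 2 ≤ inner ℝ y v ^ 2} :=
    measurableSet_le measurable_const (by fun_prop)
  have h1 := mul_norm_sq_le_integral hp v
  -- Reverse Markov inequality: the integrand is at most `1`, hence at most `σ₀ / 2` plus the
  -- indicator of the event.
  have h2 : ∫ y, inner ℝ y v ^ 2 ∂p ≤
      ∫ y, (σ₀ / 2 + {y : Vec d | σ₀ / 2 ≤ inner ℝ y v ^ 2}.indicator (fun _ => (1 : ℝ)) y) ∂p := by
    have hint : Integrable ({y : Vec d | σ₀ / 2 ≤ inner ℝ y v ^ 2}.indicator fun _ => (1 : ℝ)) p :=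
      (integrable_const _).indicator hE
    have hb : ∀ᵐ y ∂p, inner ℝ y v ^ 2 ≤ (1 : ℝ) := by
      filter_upwards [hp.norm_le_one] with y hy
      have := utility_sq_le (N := 1) (X := fun _ => y) (fun _ => hy) v 0
      simpa [utility, hv] using this
    refine integral_mono_ae ?_ ((integrable_const _).add hint) ?_
    · refine Integrable.of_bound (Measurable.aestronglyMeasurable (by fun_prop)) 1 ?_
      filter_upwards [hb] with y hy
      rwa [Real.norm_of_nonneg (sq_nonneg _)]
    · filter_upwards [hb] with y hy
      by_cases hyE : σ₀ / 2 ≤ inner ℝ y v ^ 2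
      · simp only [Set.indicator, Set.mem_ofPred_eq, hyE, if_true]
        linarith
      · simp only [Set.indicator, Set.mem_ofPred_eq, hyE, if_false]
        linarith
  rw [integral_add (integrable_const _) ((integrable_const _).indicator hE), integral_const,
    integral_indicator_const _ hE] at h2
  simp only [probReal_univ, smul_eq_mul, mul_one] at h2
  rw [hv] at h1
  linarith

/-- Whatever `K` items are picked, all `N` contexts have a large component in a given direction
with a probability that depends on `N` and `σ₀` only. -/
theorem diversityConstant_pow (hσ₀ : 0 < σ₀) (hp : BoundedContexts p σ₀) (K : ℕ) :
    DiversityConstant N K p ((2 / σ₀) ^ (N + 1)) := by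
  intro θ A hA pick hpick htop
  refine Matrix.PosSemidef.of_dotProduct_mulVec_nonneg (isHermitian_of_symm fun a b => ?_) ?_
  · simp only [expectedGram, secondMoment, Matrix.sub_apply, Matrix.smul_apply, Matrix.of_apply,
      mul_comm]
  intro w
  rw [star_trivial]
  obtain ⟨v, rfl⟩ : ∃ v : Vec d, v.ofLp = w := ⟨WithLp.toLp 2 w, rfl⟩
  rw [Matrix.sub_mulVec, dotProduct_sub, Matrix.smul_mulVec, dotProduct_smul,
    Matrix.smul_mulVec, dotProduct_smul, dotProduct_secondMoment_mulVec hp,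
    dotProduct_expectedGram_mulVec hp hpick, smul_eq_mul, smul_eq_mul, sub_nonneg]
  rcases eq_or_ne v 0 with rfl | hv0
  · simp [utility]
  have hn : 0 < ‖v‖ := norm_pos_iff.2 hv0
  set e : Vec d := (‖v‖⁻¹ : ℝ) • v with he
  have he1 : ‖e‖ = 1 := by rw [he, norm_smul, norm_inv, norm_norm, inv_mul_cancel₀ hn.ne']
  have hve : v = ‖v‖ • e := by rw [he, smul_smul, mul_inv_cancel₀ hn.ne', one_smul]
  set E : Set (Vec d) := {y | σ₀ / 2 ≤ inner ℝ y e ^ 2} with hEdef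
  have hE : MeasurableSet E := measurableSet_le measurable_const (by fun_prop)
  have hpE : σ₀ / 2 ≤ p.real E := half_le_measure_inner_sq hσ₀ hp he1
  have hsq : ∀ y : Vec d, inner ℝ y v ^ 2 = ‖v‖ ^ 2 * inner ℝ y e ^ 2 := fun y => by
    conv_lhs => rw [hve]
    rw [real_inner_smul_right]
    ring
  have hub : ∫ y, inner ℝ y v ^ 2 ∂p ≤ ‖v‖ ^ 2 := by
    calc ∫ y, inner ℝ y v ^ 2 ∂p ≤ ∫ _y, ‖v‖ ^ 2 ∂p := by
          refine integral_mono_of_nonneg (Filter.Eventually.of_forall fun _ => sq_nonneg _)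
            (integrable_const _) ?_
          filter_upwards [hp.norm_le_one] with y hy
          exact utility_sq_le (N := 1) (X := fun _ => y) (fun _ => hy) v 0
      _ = ‖v‖ ^ 2 := by simp
  -- On the event that all `N` contexts lie in `E`, any `K` of them contribute at least `K ‖v‖² σ₀ /
  -- 2`, so the dependence of `pick` on the contexts is harmless.
  have hF : MeasurableSet (Set.univ.pi fun _ : Fin N => E) :=
    MeasurableSet.univ_pi fun _ => hE
  have hmeas : (σ₀ / 2) ^ N ≤
      (Measure.pi fun _ : Fin N => p).real (Set.univ.pi fun _ : Fin N => E) := by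
    rw [measureReal_def, Measure.pi_pi, Finset.prod_const, Finset.card_univ, Fintype.card_fin,
      ENNReal.toReal_pow]
    exact pow_le_pow_left₀ (by positivity) hpE N
  have hint : Integrable (fun X => ∑ i ∈ pick X, utility X v i ^ 2)
      (Measure.pi fun _ : Fin N => p) := by
    simp only [← sum_sum_sum_utility]
    exact integrable_finsetSum _ fun a _ => integrable_finsetSum _ fun b _ =>
      (integrable_sum_pick hp hpick a b).const_mul _
  have hlb : K * (‖v‖ ^ 2 * (σ₀ / 2)) * (σ₀ / 2) ^ N ≤
      ∫ X, ∑ i ∈ pick X, utility X v i ^ 2 ∂(Measure.pi fun _ : Fin N => p) := by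
    calc K * (‖v‖ ^ 2 * (σ₀ / 2)) * (σ₀ / 2) ^ N
        ≤ K * (‖v‖ ^ 2 * (σ₀ / 2)) *
          (Measure.pi fun _ : Fin N => p).real (Set.univ.pi fun _ : Fin N => E) :=
          mul_le_mul_of_nonneg_left hmeas (by positivity)
      _ = ∫ X, (Set.univ.pi fun _ : Fin N => E).indicator
          (fun _ => K * (‖v‖ ^ 2 * (σ₀ / 2))) X ∂(Measure.pi fun _ : Fin N => p) := by
          rw [integral_indicator_const _ hF, smul_eq_mul, mul_comm]
      _ ≤ _ := by
          refine integral_mono ((integrable_const _).indicator hF) hint fun X => ?_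
          refine Set.indicator_le' (fun X hX => ?_) (fun X _ => Finset.sum_nonneg fun i _ =>
            sq_nonneg (utility X v i)) X
          rw [← (htop X).1, ← nsmul_eq_mul]
          refine Finset.card_nsmul_le_sum (pick X) (fun i => utility X v i ^ 2) _ fun i _ => ?_
          rw [utility, hsq]
          exact mul_le_mul_of_nonneg_left (hX i (Set.mem_univ i)) (sq_nonneg _)
  calc (K : ℝ) * ∫ y, inner ℝ y v ^ 2 ∂p ≤ K * ‖v‖ ^ 2 :=
        mul_le_mul_of_nonneg_left hub (Nat.cast_nonneg' K)
    -- The exponent collects `N` factors from the probability of the event and one from the size of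
    -- the squared components.
    _ = (2 / σ₀) ^ (N + 1) * (K * (‖v‖ ^ 2 * (σ₀ / 2)) * (σ₀ / 2) ^ N) := by
        have : (2 / σ₀) ^ (N + 1) * (σ₀ / 2) ^ (N + 1) = 1 := by
          rw [← mul_pow, div_mul_div_comm, mul_comm 2 σ₀, div_self (by positivity), one_pow]
        calc (K : ℝ) * ‖v‖ ^ 2 = K * ‖v‖ ^ 2 * ((2 / σ₀) ^ (N + 1) * (σ₀ / 2) ^ (N + 1)) := by
              rw [this, mul_one]
          _ = _ := by rw [pow_succ (σ₀ / 2)]; ring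
    _ ≤ _ := mul_le_mul_of_nonneg_left hlb (by positivity)

end Contexts

/-! ### Orthogonality -/

section Probability

variable {Ω : Type*} {m0 : MeasurableSpace Ω} {P : Measure Ω} [IsProbabilityMeasure P]

/-- Orthogonality kills the cross terms, so the second moment grows linearly in the number of terms.
This takes the place of a concentration inequality. -/
theorem integral_sq_sum_le {I : Finset ℕ} {f : ℕ → Ω → ℝ} {b : ℝ}
    (hf : ∀ t ∈ I, AEStronglyMeasurable (f t) P) (hb : ∀ t ∈ I, ∀ᵐ ω ∂P, |f t ω| ≤ b)
    (horth : ∀ s ∈ I, ∀ t ∈ I, s < t → ∫ ω, f s ω * f t ω ∂P = 0) :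
    ∫ ω, (∑ t ∈ I, f t ω) ^ 2 ∂P ≤ I.card * b ^ 2 := by
  have hint : ∀ s ∈ I, ∀ t ∈ I, Integrable (fun ω => f s ω * f t ω) P := by
    intro s hs t ht
    refine Integrable.of_bound ((hf s hs).mul (hf t ht)) (b * b) ?_
    filter_upwards [hb s hs, hb t ht] with ω h1 h2
    rw [norm_mul]
    exact mul_le_mul h1 h2 (norm_nonneg _) ((abs_nonneg _).trans h1)
  have hterm : ∀ s ∈ I, ∀ t ∈ I, ∫ ω, f s ω * f t ω ∂P ≤ if s = t then b ^ 2 else 0 := by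
    intro s hs t ht
    split_ifs with hst
    · subst hst
      calc ∫ ω, f s ω * f s ω ∂P ≤ ∫ _ω, b ^ 2 ∂P := by
            refine integral_mono_ae (hint s hs s hs) (integrable_const _) ?_
            filter_upwards [hb s hs] with ω h1
            rw [← sq, ← sq_abs]
            exact pow_le_pow_left₀ (abs_nonneg _) h1 2
        _ = b ^ 2 := by simp
    · rcases lt_or_gt_of_ne hst with h | h
      · exact (horth s hs t ht h).le
      · have := horth t ht s hs h
        simp only [mul_comm (f t _)] at this
        exact this.le
  calc ∫ ω, (∑ t ∈ I, f t ω) ^ 2 ∂P = ∑ s ∈ I, ∑ t ∈ I, ∫ ω, f s ω * f t ω ∂P := by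
        simp only [sq, Finset.sum_mul_sum]
        rw [integral_finsetSum _ fun s hs => integrable_finsetSum _ fun t ht => hint s hs t ht]
        exact Finset.sum_congr rfl fun s hs => integral_finsetSum _ fun t ht => hint s hs t ht
    _ ≤ ∑ s ∈ I, ∑ t ∈ I, if s = t then b ^ 2 else 0 :=
        Finset.sum_le_sum fun s hs => Finset.sum_le_sum fun t ht => hterm s hs t ht
    _ = I.card * b ^ 2 := by
        rw [Finset.sum_congr rfl fun s hs => by
          rw [Finset.sum_ite_eq I s (fun _ => b ^ 2), if_pos hs]]
        simp

/-- Pulling the `m`-measurable factor `f` out of the conditional expectation turns the integral of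
`f` over `E` into that of `f * q`. Integrability of `f * q` is inherited from the conditional
expectation. -/
theorem integral_mul_sub_indicator_eq_zero {m : MeasurableSpace Ω} (hm : m ≤ m0) {E : Set Ω}
    (hE : MeasurableSet[m0] E) {f q : Ω → ℝ} (hf : Measurable[m] f) {b : ℝ}
    (hb : ∀ᵐ ω ∂P, |f ω| ≤ b) (hq : P⟦E|m⟧ =ᵐ[P] q) :
    ∫ ω, f ω * (q ω - E.indicator (fun _ => (1 : ℝ)) ω) ∂P = 0 := by
  have hint : Integrable (E.indicator fun _ => (1 : ℝ)) P := (integrable_const _).indicator hE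
  have hfi : Integrable (f * E.indicator fun _ => (1 : ℝ)) P :=
    hint.bdd_mul (hf.mono hm le_rfl).aestronglyMeasurable hb
  have h1 := condExp_mul_of_stronglyMeasurable_left hf.stronglyMeasurable hfi hint
  have h2 : P[f * E.indicator (fun _ => (1 : ℝ)) | m] =ᵐ[P] f * q :=
    h1.trans (hq.mono fun ω h => by simp [h])
  have h3 : Integrable (f * q) P := integrable_condExp.congr h2
  have h4 := integral_condExp hm (f := f * E.indicator fun _ => (1 : ℝ)) (μ := P)
  rw [integral_congr_ae h2] at h4
  simp only [mul_sub]
  rw [integral_sub (f := fun ω => f ω * q ω)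
    (g := fun ω => f ω * E.indicator (fun _ => (1 : ℝ)) ω) h3 hfi]
  exact sub_eq_zero.2 h4

/-- By independence the joint law is a product, and Fubini allows integration over `X` with `V`
frozen. Here `X` will be the fresh contexts and `V` data from the past. -/
theorem integral_comp_indep {𝒳 𝒱 : Type*} [MeasurableSpace 𝒳] [MeasurableSpace 𝒱] {X : Ω → 𝒳}
    {V : Ω → 𝒱} (hX : Measurable X) (hV : Measurable V) (hind : IndepFun X V P)
    {F : 𝒳 → 𝒱 → ℝ} (hF : Measurable F.uncurry) (hint : Integrable (fun ω => F (X ω) (V ω)) P) :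
    ∫ ω, F (X ω) (V ω) ∂P = ∫ ω, ∫ y, F y (V ω) ∂(P.map X) ∂P := by
  have hp1 : IsProbabilityMeasure (P.map X) := Measure.isProbabilityMeasure_map hX.aemeasurable
  have hp2 : IsProbabilityMeasure (P.map V) := Measure.isProbabilityMeasure_map hV.aemeasurable
  have hmap := (indepFun_iff_map_prod_eq_prod_map_map hX.aemeasurable hV.aemeasurable).1 hind
  have hXV : Measurable fun ω => (X ω, V ω) := hX.prodMk hV
  have hint' : Integrable F.uncurry ((P.map X).prod (P.map V)) := by
    rw [← hmap, integrable_map_measure hF.aestronglyMeasurable hXV.aemeasurable]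
    exact hint
  calc ∫ ω, F (X ω) (V ω) ∂P = ∫ z, F.uncurry z ∂(P.map fun ω => (X ω, V ω)) := by
        rw [integral_map hXV.aemeasurable hF.aestronglyMeasurable]
        rfl
    _ = ∫ v, ∫ y, F y v ∂(P.map X) ∂(P.map V) := by
        rw [hmap, integral_prod_symm _ hint']
        rfl
    _ = _ := by
        rw [integral_map hV.aemeasurable]
        exact (hF.stronglyMeasurable.integral_prod_left).aestronglyMeasurable

end Probability

/-! ### Measurability of the inverse matrix -/

theorem measurable_det {Ω : Type*} {m : MeasurableSpace Ω} {d : ℕ}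
    {A : Ω → Matrix (Fin d) (Fin d) ℝ} (hA : ∀ a b, Measurable fun ω => A ω a b) :
    Measurable fun ω => (A ω).det := by
  simp only [Matrix.det_apply']
  exact Finset.measurable_fun_sum _ fun σ _ =>
    (Finset.measurable_fun_prod _ fun i _ => hA _ _).const_mul _

theorem measurable_inv_apply {Ω : Type*} {m : MeasurableSpace Ω} {d : ℕ}
    {A : Ω → Matrix (Fin d) (Fin d) ℝ} (hA : ∀ a b, Measurable fun ω => A ω a b) (a b : Fin d) :
    Measurable fun ω => (A ω)⁻¹ a b := by
  simp only [Matrix.inv_def, Ring.inverse_eq_inv', Matrix.smul_apply, smul_eq_mul,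
    Matrix.adjugate_apply]
  refine (measurable_det hA).inv.mul (measurable_det fun i j => ?_)
  simp only [Matrix.updateRow_apply]
  split_ifs
  · exact measurable_const
  · exact hA i j

/-! ### The history -/

section History

variable {Ω : Type*} {N d : ℕ} {x : ℕ → Ω → Fin N → Vec d} {S : ℕ → Ω → Finset (Fin N)}
  {c : ℕ → Ω → Option (Fin N)}

/-- The σ-algebra of the history before round `t` and the contexts and the assortment of
round `t`. -/
@[reducible] def offerHistory (x : ℕ → Ω → Fin N → Vec d) (S : ℕ → Ω → Finset (Fin N))
    (c : ℕ → Ω → Option (Fin N)) (t : ℕ) : MeasurableSpace Ω :=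
  history x S c t ⊔ MeasurableSpace.comap (x t) inferInstance ⊔ MeasurableSpace.comap (S t) ⊤

theorem history_mono {s t : ℕ} (hst : s ≤ t) : history x S c s ≤ history x S c t :=
  biSup_mono fun _ hu => Finset.Ico_subset_Ico_right hst hu

theorem observation_le_history {s t : ℕ} (hs : 1 ≤ s) (hst : s < t) :
    MeasurableSpace.comap (x s) inferInstance ⊔ MeasurableSpace.comap (S s) ⊤ ⊔
      MeasurableSpace.comap (c s) ⊤ ≤ history x S c t :=
  le_biSup (f := fun s => MeasurableSpace.comap (x s) inferInstance ⊔
    MeasurableSpace.comap (S s) ⊤ ⊔ MeasurableSpace.comap (c s) ⊤) (Finset.mem_Ico.2 ⟨hs, hst⟩)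

theorem measurable_context_history {s t : ℕ} (hs : 1 ≤ s) (hst : s < t) :
    Measurable[history x S c t] (x s) :=
  Measurable.mono (comap_measurable (x s))
    ((le_sup_left.trans le_sup_left).trans (observation_le_history hs hst)) le_rfl

theorem measurableSet_assortment_history {s t : ℕ} (hs : 1 ≤ s) (hst : s < t)
    (A : Finset (Fin N)) : MeasurableSet[history x S c t] (S s ⁻¹' {A}) :=
  ((le_sup_right.trans le_sup_left).trans (observation_le_history (x := x) hs hst)) _
    ⟨{A}, trivial, rfl⟩

theorem measurableSet_choice_history {s t : ℕ} (hs : 1 ≤ s) (hst : s < t)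
    (a : Option (Fin N)) : MeasurableSet[history x S c t] (c s ⁻¹' {a}) :=
  (le_sup_right.trans (observation_le_history (x := x) (S := S) hs hst)) _ ⟨{a}, trivial, rfl⟩

theorem comap_top_le {ι : Type*} [Countable ι] {m0 : MeasurableSpace Ω} {s : Ω → ι}
    (hs : ∀ i, MeasurableSet (s ⁻¹' {i})) : MeasurableSpace.comap s ⊤ ≤ m0 := by
  rintro _ ⟨B, -, rfl⟩
  rw [← Set.biUnion_preimage_singleton]
  exact MeasurableSet.biUnion B.to_countable fun i _ => hs i

/-! ### The score at the true parameter -/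

/-- Contribution of round `t` to the coordinate `a` of the score at `θ`. -/
def scoreTerm (θ : Vec d) (x : ℕ → Ω → Fin N → Vec d) (S : ℕ → Ω → Finset (Fin N))
    (c : ℕ → Ω → Option (Fin N)) (a : Fin d) (t : ℕ) (ω : Ω) : ℝ :=
  ∑ i ∈ S t ω, (choiceProb (utility (x t ω) θ) (S t ω) (some i) -
    (if c t ω = some i then 1 else 0)) * x t ω i a

theorem score_apply (θ : Vec d) (I : Finset ℕ) (a : Fin d) (ω : Ω) :
    score (fun t => x t ω) (fun t => S t ω) (fun t => c t ω) I θ a =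
      ∑ t ∈ I, scoreTerm θ x S c a t ω := by
  simp [score, scoreTerm]

/-- The bound does not grow with `K`: the choice probabilities sum to at most `1`, and at most one
indicator is nonzero. -/
theorem abs_scoreTerm_le {θ : Vec d} {a : Fin d} {t : ℕ} {ω : Ω} (hx : ∀ i, ‖x t ω i‖ ≤ 1) :
    |scoreTerm θ x S c a t ω| ≤ 2 := by
  calc |scoreTerm θ x S c a t ω|
      ≤ ∑ i ∈ S t ω, (choiceProb (utility (x t ω) θ) (S t ω) (some i) +
        (if c t ω = some i then 1 else 0)) := by
        refine (Finset.abs_sum_le_sum_abs _ _).trans (Finset.sum_le_sum fun i _ => ?_)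
        rw [abs_mul]
        refine (mul_le_of_le_one_right (abs_nonneg _) (abs_apply_le (hx i) a)).trans ?_
        refine (abs_sub _ _).trans ?_
        rw [abs_of_nonneg (choiceProb_nonneg _ _ _), abs_of_nonneg (by split_ifs <;> simp)]
    _ ≤ 1 + 1 := by
        rw [Finset.sum_add_distrib]
        refine add_le_add (sum_choiceProb_le_one _ _) ?_
        cases hc : c t ω with
        | none => simp
        | some j =>
          simp only [Option.some.injEq, Finset.sum_ite_eq]
          split_ifs <;> simp
    _ = 2 := by norm_num

theorem measurable_choiceProb_utility (θ : Vec d) (A : Finset (Fin N)) (a : Option (Fin N)) :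
    Measurable fun X : Fin N → Vec d => choiceProb (utility X θ) A a := by
  have h : ∀ i, Measurable fun X : Fin N → Vec d => Real.exp (utility X θ i) := fun i =>
    (measurable_utility θ i).exp
  cases a with
  | none =>
    simp only [choiceProb]
    exact measurable_const.div ((Finset.measurable_fun_sum A fun i _ => h i).const_add 1)
  | some i =>
    simp only [choiceProb]
    split_ifs
    · exact (h i).div ((Finset.measurable_fun_sum A fun i _ => h i).const_add 1)
    · exact measurable_const

theorem measurable_scoreTerm {m : MeasurableSpace Ω} {t : ℕ} (hx : Measurable[m] (x t))
    (hS : ∀ A, MeasurableSet[m] (S t ⁻¹' {A})) (hc : ∀ a, MeasurableSet[m] (c t ⁻¹' {a}))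
    (θ : Vec d) (a : Fin d) : Measurable[m] (scoreTerm θ x S c a t) := by
  unfold scoreTerm
  refine measurable_comp_of_finite (m := m) hS (f := fun A ω => ∑ i ∈ A,
    (choiceProb (utility (x t ω) θ) A (some i) - (if c t ω = some i then 1 else 0)) *
      x t ω i a) fun A => Finset.measurable_fun_sum A fun i _ => ?_
  have h1 : Measurable[m] fun ω => choiceProb (utility (x t ω) θ) A (some i) :=
    (measurable_choiceProb_utility θ A (some i)).comp hx
  have h2 : Measurable[m] fun ω => if c t ω = some i then (1 : ℝ) else 0 :=
    Measurable.ite (hc (some i)) measurable_const measurable_const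
  have h3 : Measurable[m] fun ω => x t ω i a :=
    (show Measurable fun X : Fin N → Vec d => X i a by fun_prop).comp hx
  exact (h1.sub h2).mul h3

variable [m0 : MeasurableSpace Ω] {P : Measure Ω} {p : Measure (Vec d)} {θstar : Vec d}

theorem IsEnvironment.history_le (henv : IsEnvironment P p θstar x S c)
    (hS : ∀ t A, MeasurableSet (S t ⁻¹' {A})) (t : ℕ) : history x S c t ≤ m0 :=
  iSup₂_le fun s _ => sup_le (sup_le (henv.measurable_context s).comap_le
    (comap_top_le (hS s))) (comap_top_le (henv.measurable_choice s))

theorem IsEnvironment.ae_norm_le_one [IsProbabilityMeasure p] {σ₀ : ℝ}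
    (henv : IsEnvironment P p θstar x S c) (hp : BoundedContexts p σ₀) {t : ℕ} (ht : 1 ≤ t) :
    ∀ᵐ ω ∂P, ∀ i, ‖x t ω i‖ ≤ 1 := by
  have h := hp.ae_pi (N := N)
  rw [← henv.context_law t ht] at h
  exact ae_of_ae_map (henv.measurable_context t).aemeasurable h

variable [IsProbabilityMeasure p] [IsProbabilityMeasure P] {σ₀ : ℝ}

/-- Martingale difference property: given the history, the contexts and the assortment, each
purchase indicator has the MNL probability as its conditional mean. -/
theorem IsEnvironment.integral_mul_scoreTerm (henv : IsEnvironment P p θstar x S c)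
    (hS : ∀ t A, MeasurableSet (S t ⁻¹' {A})) (hp : BoundedContexts p σ₀) {t : ℕ} (ht : 1 ≤ t)
    {h : Ω → ℝ} (hh : Measurable[history x S c t] h) {b : ℝ} (hb : ∀ᵐ ω ∂P, |h ω| ≤ b)
    (a : Fin d) : ∫ ω, h ω * scoreTerm θstar x S c a t ω ∂P = 0 := by
  have hm : offerHistory x S c t ≤ m0 := sup_le (sup_le (henv.history_le hS t)
    (henv.measurable_context t).comap_le) (comap_top_le (hS t))
  have hxm : Measurable[offerHistory x S c t] (x t) :=
    Measurable.mono (comap_measurable (x t)) (le_sup_right.trans le_sup_left) le_rfl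
  have hSm : ∀ A, MeasurableSet[offerHistory x S c t] (S t ⁻¹' {A}) := fun A =>
    (le_sup_right : _ ≤ offerHistory x S c t) _ ⟨{A}, trivial, rfl⟩
  have hhm : Measurable[offerHistory x S c t] h :=
    Measurable.mono hh (le_sup_left.trans le_sup_left) le_rfl
  have hxa : ∀ i, Measurable[offerHistory x S c t] fun ω => x t ω i a := fun i =>
    (show Measurable fun X : Fin N → Vec d => X i a by fun_prop).comp hxm
  -- Moving the condition `i ∈ S t ω` into the weight turns the sum over a random set into a sum
  -- over all items, with weights known before the choice.
  set g : Fin N → Ω → ℝ := fun i ω => h ω * (if i ∈ S t ω then x t ω i a else 0) with hg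
  have hgm : ∀ i, Measurable[offerHistory x S c t] (g i) := fun i => hhm.mul <|
    measurable_comp_of_finite (m := offerHistory x S c t) hSm
      (f := fun A ω => if i ∈ A then x t ω i a else 0) fun A => by
        split_ifs
        · exact hxa i
        · exact measurable_const
  have hgb : ∀ i, ∀ᵐ ω ∂P, |g i ω| ≤ b := by
    intro i
    filter_upwards [hb, henv.ae_norm_le_one hp ht] with ω h1 h2
    rw [hg, abs_mul]
    refine (mul_le_of_le_one_right (abs_nonneg _) ?_).trans h1
    split_ifs
    · exact abs_apply_le (h2 i) a
    · simp
  have hE : ∀ i : Fin N, MeasurableSet (c t ⁻¹' {some i}) := fun i =>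
    henv.measurable_choice t (some i)
  have hrw : ∀ ω, h ω * scoreTerm θstar x S c a t ω =
      ∑ i, g i ω * (choiceProb (utility (x t ω) θstar) (S t ω) (some i) -
        (c t ⁻¹' {some i}).indicator (fun _ => (1 : ℝ)) ω) := by
    intro ω
    rw [scoreTerm, Finset.mul_sum, ← Finset.sum_filter_add_sum_filter_not Finset.univ
      (fun i => i ∈ S t ω), Finset.filter_mem_eq_inter, Finset.univ_inter,
      Finset.sum_eq_zero (s := Finset.univ.filter fun i => i ∉ S t ω), add_zero]
    · refine Finset.sum_congr rfl fun i hi => ?_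
      simp only [hg, hi, if_true, Set.indicator, Set.mem_preimage, Set.mem_singleton_iff]
      ring
    · intro i hi
      simp only [hg, (Finset.mem_filter.1 hi).2, if_false, mul_zero, zero_mul]
  have hprob : ∀ i, Measurable fun ω => choiceProb (utility (x t ω) θstar) (S t ω) (some i) :=
    fun i => measurable_comp_of_finite (hS t)
      (f := fun A ω => choiceProb (utility (x t ω) θstar) A (some i)) fun A =>
        (measurable_choiceProb_utility θstar A (some i)).comp (henv.measurable_context t)
  simp only [hrw]
  rw [integral_finsetSum]
  · exact Finset.sum_eq_zero fun i _ =>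
      integral_mul_sub_indicator_eq_zero hm (hE i) (hgm i) (hgb i) (henv.choice_law t ht (some i))
  · intro i _
    refine Integrable.bdd_mul (c := b) ?_ ((hgm i).mono hm le_rfl).aestronglyMeasurable (hgb i)
    refine Integrable.sub (Integrable.of_bound (hprob i).aestronglyMeasurable 1 ?_)
      ((integrable_const _).indicator (hE i))
    exact Filter.Eventually.of_forall fun ω => by
      rw [Real.norm_of_nonneg (choiceProb_nonneg _ _ _)]
      exact choiceProb_le_one _ _ _

/-- Each of the `d` coordinates is a sum of orthogonal terms bounded by `2`, since earlier terms
belong to the history of later rounds. -/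
theorem IsEnvironment.integral_norm_score_sq_le (henv : IsEnvironment P p θstar x S c)
    (hS : ∀ t A, MeasurableSet (S t ⁻¹' {A})) (hp : BoundedContexts p σ₀) {I : Finset ℕ}
    (hI : ∀ t ∈ I, 1 ≤ t) :
    Integrable (fun ω => ‖score (fun t => x t ω) (fun t => S t ω) (fun t => c t ω) I θstar‖ ^ 2) P
      ∧ ∫ ω, ‖score (fun t => x t ω) (fun t => S t ω) (fun t => c t ω) I θstar‖ ^ 2 ∂P ≤
        4 * d * I.card := by
  simp only [EuclideanSpace.real_norm_sq_eq, score_apply]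
  have hmeas : ∀ t a, Measurable (scoreTerm θstar x S c a t) := fun t a =>
    measurable_scoreTerm (henv.measurable_context t) (hS t) (henv.measurable_choice t) _ a
  have hb : ∀ a, ∀ t ∈ I, ∀ᵐ ω ∂P, |scoreTerm θstar x S c a t ω| ≤ 2 := fun a t ht =>
    (henv.ae_norm_le_one hp (hI t ht)).mono fun ω hω => abs_scoreTerm_le hω
  have hint : ∀ a, Integrable (fun ω => (∑ t ∈ I, scoreTerm θstar x S c a t ω) ^ 2) P := by
    intro a
    refine Integrable.of_bound (((Finset.measurable_fun_sum I fun t _ => hmeas t a).pow_const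
      2).aestronglyMeasurable) ((I.card * 2 : ℝ) ^ 2) ?_
    filter_upwards [(Filter.eventually_all_finset I).2 (hb a)] with ω hω
    rw [norm_pow]
    refine pow_le_pow_left₀ (norm_nonneg _) ((Finset.abs_sum_le_sum_abs _ _).trans ?_) 2
    simpa using Finset.sum_le_card_nsmul I _ 2 hω
  refine ⟨integrable_finsetSum _ fun a _ => hint a, ?_⟩
  rw [integral_finsetSum _ fun a _ => hint a]
  calc ∑ a, ∫ ω, (∑ t ∈ I, scoreTerm θstar x S c a t ω) ^ 2 ∂P
      ≤ ∑ _a : Fin d, (I.card * 2 ^ 2 : ℝ) := by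
        refine Finset.sum_le_sum fun a _ => integral_sq_sum_le
          (fun t _ => (hmeas t a).aestronglyMeasurable) (hb a) fun s hs t ht hst => ?_
        refine henv.integral_mul_scoreTerm hS hp (hI t ht) ?_ (hb a s hs) a
        exact measurable_scoreTerm (measurable_context_history (hI s hs) hst)
          (measurableSet_assortment_history (hI s hs) hst)
          (measurableSet_choice_history (hI s hs) hst) _ a
    _ = 4 * d * I.card := by
        simp only [Finset.sum_const, Finset.card_univ, Fintype.card_fin, nsmul_eq_mul]
        ring

end History

/-! ### Growth of the Gram matrix -/

section Gram

variable {Ω : Type*} {N d K : ℕ} {x : ℕ → Ω → Fin N → Vec d} {S : ℕ → Ω → Finset (Fin N)}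
  {c : ℕ → Ω → Option (Fin N)}

/-- Entry `(a, b)` of the contribution of round `t` to the Gram matrix. -/
def gramTerm (x : ℕ → Ω → Fin N → Vec d) (S : ℕ → Ω → Finset (Fin N)) (a b : Fin d) (t : ℕ)
    (ω : Ω) : ℝ :=
  ∑ i ∈ S t ω, x t ω i a * x t ω i b

theorem measurable_gramTerm {m : MeasurableSpace Ω} {t : ℕ} (hx : Measurable[m] (x t))
    (hS : ∀ A, MeasurableSet[m] (S t ⁻¹' {A})) (a b : Fin d) :
    Measurable[m] (gramTerm x S a b t) := by
  have hxa : ∀ i a, Measurable[m] fun ω => x t ω i a := fun i a =>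
    (show Measurable fun X : Fin N → Vec d => X i a by fun_prop).comp hx
  exact measurable_comp_of_finite (m := m) hS (f := fun A ω => ∑ i ∈ A, x t ω i a * x t ω i b)
    fun A => Finset.measurable_fun_sum A fun i _ => (hxa i a).mul (hxa i b)

variable {𝒰 : Type*} {p : Measure (Vec d)}

/-- Deviation in round `t` of the Gram matrix from its conditional expectation, if the assortment
is selected by the rule `Z` from the contexts of the round and from the past `U`. -/
def gramDev (p : Measure (Vec d)) (x : ℕ → Ω → Fin N → Vec d) (S : ℕ → Ω → Finset (Fin N))
    (Z : (Fin N → Vec d) → 𝒰 → Finset (Fin N)) (U : Ω → 𝒰) (a b : Fin d) (t : ℕ) (ω : Ω) : ℝ :=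
  gramTerm x S a b t ω - expectedGram p (fun X => Z X (U ω)) a b

/-- Squared Frobenius norm of the sum of the deviations. -/
def gramDevSq (p : Measure (Vec d)) (x : ℕ → Ω → Fin N → Vec d) (S : ℕ → Ω → Finset (Fin N))
    (Z : ℕ → (Fin N → Vec d) → 𝒰 → Finset (Fin N)) (U : ℕ → Ω → 𝒰) (J : Finset ℕ) (ω : Ω) : ℝ :=
  ∑ a, ∑ b, (∑ t ∈ J, gramDev p x S (Z t) (U t) a b t ω) ^ 2

/-- Cauchy–Schwarz for the Frobenius inner product of `D` with `v vᵀ`. Using the Frobenius norm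
costs a power of `d`, but reduces matrix deviations to scalar second moments. -/
theorem abs_sum_sum_mul_le {d : ℕ} (v : Vec d) (D : Fin d → Fin d → ℝ) {q : ℝ} (hq : 0 ≤ q)
    (h : ∑ a, ∑ b, D a b ^ 2 ≤ q ^ 2) : |∑ a, ∑ b, v a * v b * D a b| ≤ q * ‖v‖ ^ 2 := by
  have h1 := Finset.sum_mul_sq_le_sq_mul_sq (Finset.univ : Finset (Fin d × Fin d))
    (fun z => v z.1 * v z.2) (fun z => D z.1 z.2)
  simp only [← Finset.univ_product_univ, Finset.sum_product] at h1
  have h2 : ∑ a, ∑ b, (v a * v b) ^ 2 = (‖v‖ ^ 2) ^ 2 := by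
    rw [EuclideanSpace.real_norm_sq_eq, sq (∑ i, _), Finset.sum_mul_sum]
    simp only [mul_pow]
  rw [h2] at h1
  refine abs_le_of_sq_le_sq (h1.trans ?_) (by positivity)
  rw [mul_pow, mul_comm (q ^ 2)]
  exact mul_le_mul_of_nonneg_left h (by positivity)

/-- If the deviations are small, the Gram matrix is large. -/
theorem gram_ge_of_gramDevSq_le {M q lam : ℝ} {J : Finset ℕ} {ω : Ω} (hq : 0 ≤ q) (hM : 0 < M)
    {Z : ℕ → (Fin N → Vec d) → 𝒰 → Finset (Fin N)} {U : ℕ → Ω → 𝒰}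
    (hE : ∀ t ∈ J, ∀ v : Vec d, lam * ‖v‖ ^ 2 ≤
      M * (v.ofLp ⬝ᵥ (expectedGram p fun X => Z t X (U t ω)).mulVec v.ofLp))
    (hQ : gramDevSq p x S Z U J ω ≤ q ^ 2) (v : Vec d) :
    (J.card * (lam / M) - q) * ‖v‖ ^ 2 ≤ ∑ t ∈ J, ∑ i ∈ S t ω, utility (x t ω) v i ^ 2 := by
  have h1 := (abs_le.1 (abs_sum_sum_mul_le v _ hq hQ)).1
  have h2 : ∑ a, ∑ b, v a * v b * ∑ t ∈ J, gramDev p x S (Z t) (U t) a b t ω =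
      ∑ t ∈ J, ((∑ i ∈ S t ω, utility (x t ω) v i ^ 2) -
        v.ofLp ⬝ᵥ (expectedGram p fun X => Z t X (U t ω)).mulVec v.ofLp) := by
    simp only [dotProduct_mulVec_eq_sum, ← sum_sum_sum_utility, ← Finset.sum_sub_distrib,
      ← mul_sub]
    rw [Finset.sum_comm' (t' := Finset.univ) (s' := fun _ => J) (by simp)]
    refine Finset.sum_congr rfl fun a _ => ?_
    rw [Finset.sum_comm]
    refine Finset.sum_congr rfl fun b _ => ?_
    rw [Finset.mul_sum]
    rfl
  rw [h2, Finset.sum_sub_distrib] at h1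
  have h3 : J.card * (lam / M * ‖v‖ ^ 2) ≤
      ∑ t ∈ J, v.ofLp ⬝ᵥ (expectedGram p fun X => Z t X (U t ω)).mulVec v.ofLp := by
    rw [← nsmul_eq_mul]
    refine Finset.card_nsmul_le_sum J (fun t =>
      v.ofLp ⬝ᵥ (expectedGram p fun X => Z t X (U t ω)).mulVec v.ofLp) _ fun t ht => ?_
    rw [div_mul_eq_mul_div, div_le_iff₀ hM, mul_comm _ M]
    exact hE t ht v
  linarith

variable [IsProbabilityMeasure p] {σ₀ : ℝ}

theorem abs_expectedGram_le (hp : BoundedContexts p σ₀)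
    {pick : (Fin N → Vec d) → Finset (Fin N)} (hK : ∀ X, (pick X).card ≤ K) (a b : Fin d) :
    |expectedGram p pick a b| ≤ K := by
  have h := norm_integral_le_of_norm_le_const (μ := Measure.pi fun _ : Fin N => p)
    (f := fun X => ∑ i ∈ pick X, X i a * X i b) (C := K) (by
      filter_upwards [hp.ae_pi] with X hX
      exact (abs_sum_le_card fun i => abs_apply_mul_apply_le (hX i) a b).trans
        (by exact_mod_cast hK X))
  simpa [expectedGram] using h

section

variable [MeasurableSpace 𝒰]

theorem measurable_sum_rule {Z : (Fin N → Vec d) → 𝒰 → Finset (Fin N)}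
    (hZ : ∀ A, MeasurableSet (Z.uncurry ⁻¹' {A})) (a b : Fin d) :
    Measurable (fun (X : Fin N → Vec d) (u : 𝒰) => ∑ i ∈ Z X u, X i a * X i b).uncurry :=
  measurable_comp_of_finite hZ (f := fun A (z : (Fin N → Vec d) × 𝒰) =>
    ∑ i ∈ A, z.1 i a * z.1 i b) fun A => Finset.measurable_fun_sum A fun i _ => by fun_prop

theorem measurableSet_rule {Z : (Fin N → Vec d) → 𝒰 → Finset (Fin N)}
    (hZ : ∀ A, MeasurableSet (Z.uncurry ⁻¹' {A})) (u : 𝒰) (A : Finset (Fin N)) :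
    MeasurableSet ((fun X => Z X u) ⁻¹' {A}) :=
  (measurable_id.prodMk measurable_const : Measurable fun X : Fin N → Vec d => (X, u)) (hZ A)

theorem measurable_expectedGram {Z : (Fin N → Vec d) → 𝒰 → Finset (Fin N)}
    (hZ : ∀ A, MeasurableSet (Z.uncurry ⁻¹' {A})) (a b : Fin d) :
    Measurable fun u => expectedGram p (fun X => Z X u) a b :=
  ((measurable_sum_rule hZ a b).stronglyMeasurable.integral_prod_left
    (μ := Measure.pi fun _ : Fin N => p)).measurable

theorem measurable_gramDev {m : MeasurableSpace Ω} {t : ℕ} (hx : Measurable[m] (x t))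
    (hS : ∀ A, MeasurableSet[m] (S t ⁻¹' {A})) {Z : (Fin N → Vec d) → 𝒰 → Finset (Fin N)}
    (hZ : ∀ A, MeasurableSet (Z.uncurry ⁻¹' {A})) {U : Ω → 𝒰} (hU : Measurable[m] U)
    (a b : Fin d) : Measurable[m] (gramDev p x S Z U a b t) :=
  (measurable_gramTerm hx hS a b).sub ((measurable_expectedGram hZ a b).comp hU)

end

variable [m0 : MeasurableSpace Ω] {P : Measure Ω} {θstar : Vec d}

theorem IsEnvironment.abs_gramDev_le (henv : IsEnvironment P p θstar x S c)
    (hp : BoundedContexts p σ₀) {t : ℕ} (ht : 1 ≤ t)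
    {Z : (Fin N → Vec d) → 𝒰 → Finset (Fin N)} (hK : ∀ X u, (Z X u).card ≤ K) {U : Ω → 𝒰}
    (hSZ : ∀ᵐ ω ∂P, S t ω = Z (x t ω) (U ω)) (a b : Fin d) :
    ∀ᵐ ω ∂P, |gramDev p x S Z U a b t ω| ≤ 2 * K := by
  filter_upwards [henv.ae_norm_le_one hp ht, hSZ] with ω h1 h2
  have h3 : |gramTerm x S a b t ω| ≤ K := by
    refine (abs_sum_le_card fun i => abs_apply_mul_apply_le (h1 i) a b).trans ?_
    rw [h2]
    exact_mod_cast hK _ _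
  have h4 := abs_expectedGram_le hp (fun X => hK X (U ω)) a b
  refine (abs_sub _ _).trans ?_
  linarith

variable [MeasurableSpace 𝒰] [IsProbabilityMeasure P]

/-- The contexts of round `t` are independent of the past, so with `U` and `h` frozen the mean
contribution of the round is `expectedGram` of the rule with parameter `U`. The deviation is thus
orthogonal to the history. -/
theorem IsEnvironment.integral_mul_gramDev (henv : IsEnvironment P p θstar x S c)
    (hS : ∀ t A, MeasurableSet (S t ⁻¹' {A})) (hp : BoundedContexts p σ₀) {t : ℕ} (ht : 1 ≤ t)
    {Z : (Fin N → Vec d) → 𝒰 → Finset (Fin N)} (hZ : ∀ A, MeasurableSet (Z.uncurry ⁻¹' {A}))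
    (hK : ∀ X u, (Z X u).card ≤ K) {U : Ω → 𝒰} (hU : Measurable[history x S c t] U)
    (hSZ : ∀ᵐ ω ∂P, S t ω = Z (x t ω) (U ω))
    {h : Ω → ℝ} (hh : Measurable[history x S c t] h) {B : ℝ} (hB : ∀ᵐ ω ∂P, |h ω| ≤ B)
    (a b : Fin d) : ∫ ω, h ω * gramDev p x S Z U a b t ω ∂P = 0 := by
  have hle := henv.history_le hS t
  have hU0 : Measurable U := hU.mono hle le_rfl
  have hh0 : Measurable h := hh.mono hle le_rfl
  have hx := henv.measurable_context t
  set F : (Fin N → Vec d) → 𝒰 × ℝ → ℝ := fun X v => v.2 * ∑ i ∈ Z X v.1, X i a * X i b with hF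
  have hFm : Measurable F.uncurry := by
    have hproj : Measurable fun z : (Fin N → Vec d) × 𝒰 × ℝ => (z.1, z.2.1) := by fun_prop
    exact (measurable_snd.comp measurable_snd).mul ((measurable_sum_rule hZ a b).comp hproj)
  have hind : IndepFun (x t) (fun ω => (U ω, h ω)) P := by
    rw [IndepFun_iff_Indep]
    refine indep_of_indep_of_le_right (henv.context_indep t ht) ?_
    exact (Measurable.prodMk hU hh).comap_le
  have hgt : ∀ᵐ ω ∂P, h ω * gramTerm x S a b t ω = F (x t ω) (U ω, h ω) := by
    filter_upwards [hSZ] with ω hω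
    simp only [gramTerm, hω, hF]
  have hgm : Measurable (gramTerm x S a b t) := measurable_gramTerm hx (hS t) a b
  have hgi : Integrable (gramTerm x S a b t) P := by
    refine Integrable.of_bound hgm.aestronglyMeasurable K ?_
    filter_upwards [henv.ae_norm_le_one hp ht, hSZ] with ω h1 h2
    refine (abs_sum_le_card fun i => abs_apply_mul_apply_le (h1 i) a b).trans ?_
    rw [h2]
    exact_mod_cast hK _ _
  have hi1 : Integrable (fun ω => h ω * gramTerm x S a b t ω) P :=
    hgi.bdd_mul hh0.aestronglyMeasurable hB
  have hi2 : Integrable (fun ω => h ω * expectedGram p (fun X => Z X (U ω)) a b) P := by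
    refine Integrable.bdd_mul (c := B) ?_ hh0.aestronglyMeasurable hB
    exact Integrable.of_bound ((measurable_expectedGram hZ a b).comp hU0).aestronglyMeasurable K
      (Filter.Eventually.of_forall fun ω => abs_expectedGram_le hp (fun X => hK X (U ω)) a b)
  have hfr := integral_comp_indep hx (hU0.prodMk hh0) hind hFm (hi1.congr hgt)
  simp only [gramDev, mul_sub]
  rw [integral_sub hi1 hi2, integral_congr_ae hgt, hfr, henv.context_law t ht, sub_eq_zero]
  refine integral_congr_ae (Filter.Eventually.of_forall fun ω => ?_)
  simp only [hF, expectedGram, Matrix.of_apply]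
  rw [integral_const_mul]

/-- Each of the `d ^ 2` entries is a sum of orthogonal terms bounded by `2 * K`. -/
theorem IsEnvironment.integral_gramDevSq_le (henv : IsEnvironment P p θstar x S c)
    (hS : ∀ t A, MeasurableSet (S t ⁻¹' {A})) (hp : BoundedContexts p σ₀) {J : Finset ℕ}
    (hJ : ∀ t ∈ J, 1 ≤ t) {Z : ℕ → (Fin N → Vec d) → 𝒰 → Finset (Fin N)}
    (hZ : ∀ t A, MeasurableSet ((Z t).uncurry ⁻¹' {A}))
    (hK : ∀ t X u, (Z t X u).card ≤ K) {U : ℕ → Ω → 𝒰}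
    (hU : ∀ t ∈ J, Measurable[history x S c t] (U t))
    (hSZ : ∀ t ∈ J, ∀ᵐ ω ∂P, S t ω = Z t (x t ω) (U t ω)) :
    Integrable (gramDevSq p x S Z U J) P ∧
      ∫ ω, gramDevSq p x S Z U J ω ∂P ≤ d ^ 2 * (J.card * (2 * K) ^ 2) := by
  have hmeas : ∀ a b, ∀ t ∈ J, Measurable (gramDev p x S (Z t) (U t) a b t) := fun a b t ht =>
    measurable_gramDev (henv.measurable_context t) (hS t) (hZ t)
      ((hU t ht).mono (henv.history_le hS t) le_rfl) a b
  have hb : ∀ a b, ∀ t ∈ J, ∀ᵐ ω ∂P, |gramDev p x S (Z t) (U t) a b t ω| ≤ 2 * K :=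
    fun a b t ht => henv.abs_gramDev_le hp (hJ t ht) (hK t) (hSZ t ht) a b
  have hint : ∀ a b, Integrable
      (fun ω => (∑ t ∈ J, gramDev p x S (Z t) (U t) a b t ω) ^ 2) P := by
    intro a b
    refine Integrable.of_bound (((Finset.measurable_fun_sum J fun t ht =>
      hmeas a b t ht).pow_const 2).aestronglyMeasurable) ((J.card * (2 * K) : ℝ) ^ 2) ?_
    filter_upwards [(Filter.eventually_all_finset J).2 (hb a b)] with ω hω
    rw [norm_pow]
    refine pow_le_pow_left₀ (norm_nonneg _) ((Finset.abs_sum_le_sum_abs _ _).trans ?_) 2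
    simpa using Finset.sum_le_card_nsmul J _ (2 * K : ℝ) hω
  have hint' : ∀ a, Integrable
      (fun ω => ∑ b, (∑ t ∈ J, gramDev p x S (Z t) (U t) a b t ω) ^ 2) P :=
    fun a => integrable_finsetSum _ fun b _ => hint a b
  refine ⟨integrable_finsetSum _ fun a _ => hint' a, ?_⟩
  simp only [gramDevSq]
  rw [integral_finsetSum _ fun a _ => hint' a]
  calc ∑ a, ∫ ω, ∑ b, (∑ t ∈ J, gramDev p x S (Z t) (U t) a b t ω) ^ 2 ∂P
      = ∑ a, ∑ b, ∫ ω, (∑ t ∈ J, gramDev p x S (Z t) (U t) a b t ω) ^ 2 ∂P :=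
        Finset.sum_congr rfl fun a _ => integral_finsetSum _ fun b _ => hint a b
    _ ≤ ∑ _a : Fin d, ∑ _b : Fin d, (J.card * (2 * K) ^ 2 : ℝ) := by
        refine Finset.sum_le_sum fun a _ => Finset.sum_le_sum fun b _ => integral_sq_sum_le
          (fun t ht => (hmeas a b t ht).aestronglyMeasurable) (hb a b) fun s hs t ht hst => ?_
        refine henv.integral_mul_gramDev hS hp (hJ t ht) (hZ t) (hK t) (hU t ht) (hSZ t ht)
          ?_ (hb a b s hs) a b
        exact measurable_gramDev (measurable_context_history (hJ s hs) hst)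
          (measurableSet_assortment_history (hJ s hs) hst) (hZ s)
          ((hU s hs).mono (history_mono hst.le) le_rfl) a b
    _ = d ^ 2 * (J.card * (2 * K) ^ 2) := by
        simp only [Finset.sum_const, Finset.card_univ, Fintype.card_fin, nsmul_eq_mul]
        ring

end Gram

/-! ### Rounds without exploration -/

/-- In these rounds DBL-MNL maximizes the optimistic revenue, whatever the data are. -/
def IsExploitRound (N d K : ℕ) (κ σ₀ : ℝ) (t : ℕ) : Prop :=
  d < t ∧ qParam N d K κ σ₀ (episode t) < (tau d (episode t) : ℝ) - t

theorem two_le_episode {t : ℕ} (ht : 2 ≤ t) : 2 ≤ episode t := by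
  have := Nat.clog_pos one_lt_two ht
  unfold episode
  omega

/-- The data of the previous episode are complete before round `t`, so the quantities used in an
episode are fixed by the past. -/
theorem tau_pred_episode_lt {d t : ℕ} (hd : 1 ≤ d) (ht : d < t) : tau d (episode t - 1) < t := by
  have h1 := two_le_episode (t := t) (by omega)
  unfold tau
  split_ifs with h2 h3
  · omega
  · exact ht
  · exact Nat.pow_pred_clog_lt_self one_lt_two (by omega)

/-- Optimistic utilities as a function of the contexts `X` and of the estimate and the inverse
Gram matrix in `u`. -/
def optScore {N d : ℕ} (α : ℝ) (X : Fin N → Vec d) (u : Vec d × (Fin d → Fin d → ℝ)) :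
    Fin N → ℝ := fun i => inner ℝ (X i) u.1 + α * weightedNorm (Matrix.of u.2) (X i)

theorem measurable_optScore {N d : ℕ} (α : ℝ) :
    Measurable (optScore (N := N) (d := d) α).uncurry := by
  refine measurable_pi_lambda _ fun i => ?_
  simp only [Function.uncurry, optScore, weightedNorm, dotProduct_mulVec_eq_sum, Matrix.of_apply]
  fun_prop

section Rounds

variable {Ω : Type*} {N d K : ℕ} {κ σ₀ : ℝ} {x : ℕ → Ω → Fin N → Vec d}
  {S : ℕ → Ω → Finset (Fin N)} {c : ℕ → Ω → Option (Fin N)} {θhat : ℕ → Ω → Vec d}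

/-- The estimate and the inverse Gram matrix that are used in episode `k`. -/
def episodeData (x : ℕ → Ω → Fin N → Vec d) (S : ℕ → Ω → Finset (Fin N))
    (θhat : ℕ → Ω → Vec d) (k : ℕ) (ω : Ω) : Vec d × (Fin d → Fin d → ℝ) :=
  (θhat k ω, fun a b => (gram (fun t => x t ω) (fun t => S t ω)
    (Finset.Ioc (tau d (k - 2)) (tau d (k - 1))))⁻¹ a b)

theorem alpha_nonneg (hκ : 0 < κ) (k : ℕ) : 0 ≤ alpha N d κ k := by
  unfold alpha
  positivity

theorem measurable_episodeData_of_gram {m : MeasurableSpace Ω} {k : ℕ} (hθ : Measurable[m] (θhat k))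
    (hgram : ∀ a b, Measurable[m] fun ω => gram (fun t => x t ω) (fun t => S t ω)
      (Finset.Ioc (tau d (k - 2)) (tau d (k - 1))) a b) :
    Measurable[m] (episodeData x S θhat k) :=
  hθ.prodMk <| measurable_pi_lambda _ fun a => measurable_pi_lambda _ fun b =>
    measurable_inv_apply hgram a b

variable {r : ℝ} {θstar : Vec d} {sel : (Fin N → ℝ) → Finset (Fin N)}

theorem measurableSet_sel_optScore (hsel : IsArgmaxRule K (fun _ => r) sel) (α : ℝ)
    (A : Finset (Fin N)) :
    MeasurableSet ((fun (X : Fin N → Vec d) u => sel (optScore α X u)).uncurry ⁻¹' {A}) :=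
  measurable_optScore α (hsel.measurable A)

/-- The regret of a single round. -/
def roundRegret (K : ℕ) (r : ℝ) (θstar : Vec d) (x : ℕ → Ω → Fin N → Vec d)
    (S : ℕ → Ω → Finset (Fin N)) (t : ℕ) (ω : Ω) : ℝ :=
  optRevenue K (fun _ => r) (utility (x t ω) θstar) -
    revenue (fun _ => r) (utility (x t ω) θstar) (S t ω)

theorem abs_roundRegret_le (hr : |r| ≤ 1) (t : ℕ) (ω : Ω) :
    |roundRegret K r θstar x S t ω| ≤ 2 := by
  have h1 := abs_optRevenue_le_one (K := K) hr (utility (x t ω) θstar)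
  have h2 := abs_revenue_le_one hr (utility (x t ω) θstar) (S t ω)
  exact (abs_sub _ _).trans (by linarith)

theorem measurable_revenue_utility (A : Finset (Fin N)) :
    Measurable fun X : Fin N → Vec d => revenue (fun _ => r) (utility X θstar) A :=
  Finset.measurable_fun_sum _ fun i _ =>
    (measurable_choiceProb_utility θstar A (some i)).const_mul r

/-- If the Gram matrix of the data is large and the score at `θstar` is small, the regret of
a round without exploration is small. -/
theorem roundRegret_le_of_gram_ge (hr : |r| ≤ 1) (hsel : IsArgmaxRule K (fun _ => r) sel)
    (hκ : 0 < κ) {lam : ℝ} (hlam : 0 < lam) {t : ℕ} {ω : Ω} {J : Finset ℕ}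
    (hJ : J ⊆ Finset.Ioc (tau d (episode t - 2)) (tau d (episode t - 1)))
    (hx : ∀ i, ‖x t ω i‖ ≤ 1)
    (hS : S t ω = sel (optScore (alpha N d κ (episode t)) (x t ω)
      (episodeData x S θhat (episode t) ω)))
    (hest : (∃ θ, score (fun t => x t ω) (fun t => S t ω) (fun t => c t ω)
        (Finset.Ioc (tau d (episode t - 2)) (tau d (episode t - 1))) θ = 0) →
      score (fun t => x t ω) (fun t => S t ω) (fun t => c t ω)
        (Finset.Ioc (tau d (episode t - 2)) (tau d (episode t - 1))) (θhat (episode t) ω) = 0)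
    (hbound : ∀ t ∈ J, ∀ i ∈ S t ω, ∀ θ : Vec d, ‖θ - θstar‖ ≤ 1 →
      κ ≤ choiceProb (utility (x t ω) θ) (S t ω) (some i) *
        choiceProb (utility (x t ω) θ) (S t ω) none)
    (hgram : ∀ v : Vec d, lam * ‖v‖ ^ 2 ≤ ∑ t ∈ J, ∑ i ∈ S t ω, utility (x t ω) v i ^ 2)
    (hZ : ‖score (fun t => x t ω) (fun t => S t ω) (fun t => c t ω)
      (Finset.Ioc (tau d (episode t - 2)) (tau d (episode t - 1))) θstar‖ < κ * lam) :
    roundRegret K r θstar x S t ω ≤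
      2 * (‖score (fun t => x t ω) (fun t => S t ω) (fun t => c t ω)
        (Finset.Ioc (tau d (episode t - 2)) (tau d (episode t - 1))) θstar‖ / (κ * lam) +
        alpha N d κ (episode t) / Real.sqrt lam) := by
  set I := Finset.Ioc (tau d (episode t - 2)) (tau d (episode t - 1)) with hI
  have hz := exists_score_eq_zero (x := fun t => x t ω) (S := fun t => S t ω)
    (fun t => c t ω) hκ hJ hbound hgram hZ
  have hθ := norm_sub_le_of_score_eq_zero (x := fun t => x t ω) (S := fun t => S t ω)
    (fun t => c t ω) hκ hlam hJ hbound hgram hZ (hest hz)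
  have hgramI : ∀ v : Vec d, lam * ‖v‖ ^ 2 ≤
      v.ofLp ⬝ᵥ (gram (fun t => x t ω) (fun t => S t ω) I).mulVec v.ofLp := by
    intro v
    rw [dotProduct_gram_mulVec]
    exact (hgram v).trans (Finset.sum_le_sum_of_subset_of_nonneg hJ fun _ _ _ =>
      Finset.sum_nonneg fun _ _ => sq_nonneg _)
  have hα := alpha_nonneg (N := N) (d := d) hκ (episode t)
  rw [roundRegret, hS]
  -- Estimation error and bonus together bound the distance between the true and the optimistic
  -- utilities.
  refine optRevenue_sub_revenue_le hr hsel _ _ (by positivity) fun i => ?_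
  have h1 : |inner ℝ (x t ω i) (θhat (episode t) ω - θstar)| ≤
      ‖score (fun t => x t ω) (fun t => S t ω) (fun t => c t ω) I θstar‖ / (κ * lam) := by
    refine (abs_real_inner_le_norm _ _).trans (le_trans ?_ hθ)
    exact (mul_le_mul_of_nonneg_right (hx i) (norm_nonneg _)).trans_eq (one_mul _)
  have h2 := weightedNorm_inv_le (isHermitian_gram _ _ _) hlam hgramI (hx i)
  have h3 : utility (x t ω) θstar i - optScore (alpha N d κ (episode t)) (x t ω)
      (episodeData x S θhat (episode t) ω) i =
      -(inner ℝ (x t ω i) (θhat (episode t) ω - θstar) + alpha N d κ (episode t) *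
        weightedNorm (gram (fun t => x t ω) (fun t => S t ω) I)⁻¹ (x t ω i)) := by
    simp only [utility, optScore, episodeData, inner_sub_right]
    rw [← hI]
    change _ - (_ + _ * weightedNorm (gram (fun t => x t ω) (fun t => S t ω) I)⁻¹ (x t ω i)) = _
    ring
  rw [h3, abs_neg]
  refine (abs_add_le _ _).trans (add_le_add h1 ?_)
  have hw : 0 ≤ weightedNorm (gram (fun t => x t ω) (fun t => S t ω) I)⁻¹ (x t ω i) :=
    Real.sqrt_nonneg _
  rw [abs_of_nonneg (mul_nonneg hα hw), div_eq_mul_one_div]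
  exact mul_le_mul_of_nonneg_left h2 hα

variable [m0 : MeasurableSpace Ω] {P : Measure Ω} {p : Measure (Vec d)}

theorem IsDBLMNL.measurable_episodeData (halg : IsDBLMNL P K κ σ₀ sel x S c θhat) (hd : 1 ≤ d)
    {t : ℕ} (ht : d < t) :
    Measurable[history x S c t] (episodeData x S θhat (episode t)) := by
  have hlt := tau_pred_episode_lt hd ht
  refine measurable_episodeData_of_gram (Measurable.mono
    (halg.measurable_estimate _ (two_le_episode (by omega))) (history_mono hlt) le_rfl)
    fun a b => ?_
  simp only [gram_apply]
  refine Finset.measurable_fun_sum _ fun s hs => ?_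
  rw [Finset.mem_Ioc] at hs
  exact measurable_gramTerm (measurable_context_history (by omega) (by omega))
    (measurableSet_assortment_history (by omega) (by omega)) a b

theorem IsDBLMNL.ae_eq_sel (halg : IsDBLMNL P K κ σ₀ sel x S c θhat) {t : ℕ} (hd : 1 ≤ d)
    (ht : IsExploitRound N d K κ σ₀ t) :
    ∀ᵐ ω ∂P, S t ω = sel (optScore (alpha N d κ (episode t)) (x t ω)
      (episodeData x S θhat (episode t) ω)) := by
  filter_upwards [halg.exploit t (by have := ht.1; omega)] with ω hω
  refine hω fun hex => ?_
  rcases hex with h | h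
  · exact absurd ht.1 (by omega)
  · linarith [ht.2, h.1]

theorem integrable_roundRegret [IsProbabilityMeasure P] (henv : IsEnvironment P p θstar x S c)
    (hS : ∀ t A, MeasurableSet (S t ⁻¹' {A})) (hr : |r| ≤ 1) (t : ℕ) :
    Integrable (roundRegret K r θstar x S t) P := by
  have hx := henv.measurable_context t
  refine Integrable.of_bound (Measurable.aestronglyMeasurable (Measurable.sub ?_ ?_)) 2
    (Filter.Eventually.of_forall fun ω => abs_roundRegret_le hr t ω)
  · have h := Finset.measurable_sup' (assortments_nonempty N K)
      (f := fun A (X : Fin N → Vec d) => revenue (fun _ => r) (utility X θstar) A)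
      fun A _ => measurable_revenue_utility A
    convert h.comp hx using 1
    ext ω
    simp [optRevenue, Finset.sup'_apply]
  · exact measurable_comp_of_finite (hS t)
      (f := fun A ω => revenue (fun _ => r) (utility (x t ω) θstar) A)
      fun A => (measurable_revenue_utility A).comp hx

theorem IsDBLMNL.integral_roundRegret_nonpos (halg : IsDBLMNL P K κ σ₀ sel x S c θhat)
    (hsel : IsArgmaxRule K (fun _ => r) sel) (hd : 1 ≤ d) (hr : r ≤ 0) {t : ℕ}
    (ht : IsExploitRound N d K κ σ₀ t) : ∫ ω, roundRegret K r θstar x S t ω ∂P ≤ 0 := by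
  refine integral_nonpos_of_ae ?_
  filter_upwards [halg.ae_eq_sel hd ht] with ω hω
  rw [roundRegret, hω]
  exact optRevenue_sub_revenue_le_zero hr hsel _ _

end Rounds

/-! ### Expected regret of a round without exploration -/

section Expected

variable {Ω : Type*} {N d K : ℕ} {κ σ₀ : ℝ} {x : ℕ → Ω → Fin N → Vec d}
  {S : ℕ → Ω → Finset (Fin N)} {c : ℕ → Ω → Option (Fin N)} {θhat : ℕ → Ω → Vec d}
  {p : Measure (Vec d)} {r : ℝ} {θstar : Vec d} {sel : (Fin N → ℝ) → Finset (Fin N)}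

theorem IsEnvironment.ae_choiceProb_bound [MeasurableSpace Ω] {P : Measure Ω}
    (henv : IsEnvironment P p θstar x S c)
    (hcp : ChoiceProbBound N K p θstar κ) {t : ℕ} (ht : 1 ≤ t) :
    ∀ᵐ ω ∂P, ∀ A ∈ assortments N K, ∀ i ∈ A, ∀ θ : Vec d, ‖θ - θstar‖ ≤ 1 →
      κ ≤ choiceProb (utility (x t ω) θ) A (some i) * choiceProb (utility (x t ω) θ) A none := by
  have h := hcp
  rw [ChoiceProbBound, ← henv.context_law t ht] at h
  exact ae_of_ae_map (henv.measurable_context t).aemeasurable h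

variable [IsProbabilityMeasure p]

/-- The rule by which the assortment of a round without exploration is selected. -/
def exploitRule (N d : ℕ) (κ : ℝ) (sel : (Fin N → ℝ) → Finset (Fin N)) (t : ℕ)
    (X : Fin N → Vec d) (u : Vec d × (Fin d → Fin d → ℝ)) : Finset (Fin N) :=
  sel (optScore (alpha N d κ (episode t)) X u)

/-- For frozen episode data the rule picks the top `K` scores `⟪y, θhat⟫ + ‖y‖_A` with `A = α² W⁻¹`,
as the diversity constant requires. -/
theorem mul_norm_sq_le_expectedGram {M M' : ℝ} (hM : DiversityConstant N K p M) (hMM' : M ≤ M')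
    (hp : BoundedContexts p σ₀) (hKN : K ≤ N) (hκ : 0 < κ) (hr : 0 < r)
    (hsel : IsArgmaxRule K (fun _ => r) sel) (t : ℕ) (ω : Ω) (v : Vec d) :
    K * σ₀ * ‖v‖ ^ 2 ≤ M' * (v.ofLp ⬝ᵥ (expectedGram p fun X => exploitRule N d κ sel t X
      (episodeData x S θhat (episode t) ω)).mulVec v.ofLp) := by
  have hα := alpha_nonneg (N := N) (d := d) hκ (episode t)
  refine hM.mul_norm_sq_le hMM' hp (θhat (episode t) ω)
    (A := alpha N d κ (episode t) ^ 2 • (gram (fun t => x t ω) (fun t => S t ω)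
      (Finset.Ioc (tau d (episode t - 2)) (tau d (episode t - 1))))⁻¹)
    ((posSemidef_gram _ _ _).inv.smul (sq_nonneg _))
    (fun B => measurableSet_rule (measurableSet_sel_optScore hsel _) _ B) (fun X => ?_) v
  have h := hsel.isTopSet hKN hr (optScore (alpha N d κ (episode t)) X
    (episodeData x S θhat (episode t) ω))
  convert h using 2 with i
  rw [← mul_weightedNorm hα]
  rfl

variable [m0 : MeasurableSpace Ω] {P : Measure Ω}

variable [IsProbabilityMeasure P]

/-- Replaces a first power by a square, so that only second moments have to be integrated. -/
theorem le_add_sq_div {a s : ℝ} (hs : 0 < s) : a ≤ s + a ^ 2 / s := by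
  rw [← sub_le_iff_le_add', le_div_iff₀ hs]
  nlinarith [sq_nonneg (a - s), sq_nonneg a, sq_nonneg s]

/-- The expected regret of a round without exploration is of order `L ^ (-1/2)`, if there were
`L` such rounds among the at most `2 L` rounds of the previous episode. -/
theorem IsDBLMNL.integral_roundRegret_le (halg : IsDBLMNL P K κ σ₀ sel x S c θhat)
    (henv : IsEnvironment P p θstar x S c) (hp : BoundedContexts p σ₀)
    (hcp : ChoiceProbBound N K p θstar κ) (hsel : IsArgmaxRule K (fun _ => r) sel)
    {M M' : ℝ} (hM : DiversityConstant N K p M) (hMM' : M ≤ M') (hM' : 0 < M')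
    (hκ : 0 < κ) (hσ₀ : 0 < σ₀) (hd : 1 ≤ d) (hK : 1 ≤ K) (hKN : K ≤ N) (hr0 : 0 < r)
    (hr : |r| ≤ 1) {t L : ℕ} (hL : 1 ≤ L) {J : Finset ℕ} (ht : IsExploitRound N d K κ σ₀ t)
    (hJ : J ⊆ Finset.Ioc (tau d (episode t - 2)) (tau d (episode t - 1)))
    (hJe : ∀ s ∈ J, IsExploitRound N d K κ σ₀ s) (hJL : J.card = L)
    (hIL : (Finset.Ioc (tau d (episode t - 2)) (tau d (episode t - 1))).card ≤ 2 * L) :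
    ∫ ω, roundRegret K r θstar x S t ω ∂P ≤
      (8 * d ^ 2 * K ^ 2 / (σ₀ / (2 * M')) ^ 2 + 16 * d / (κ * (σ₀ / (2 * M'))) ^ 2 +
        (2 + 16 * d) / (κ * (σ₀ / (2 * M'))) +
        2 * alpha N d κ (episode t) / Real.sqrt (σ₀ / (2 * M'))) / Real.sqrt L := by
  set I := Finset.Ioc (tau d (episode t - 2)) (tau d (episode t - 1)) with hI
  set α := alpha N d κ (episode t) with hα_def
  have hα : 0 ≤ α := alpha_nonneg hκ _
  -- The mean Gram matrix of the rounds in `J` is at least `2 e K L`. A deviation of at most `e L`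
  -- leaves at least `e L`, since `K ≥ 1`.
  set e := σ₀ / (2 * M') with he_def
  have he : 0 < e := by positivity
  have hL0 : (0 : ℝ) < L := by exact_mod_cast hL
  have hS := halg.measurable_assortment
  have hI1 : ∀ s ∈ I, 1 ≤ s := fun s hs => by rw [hI, Finset.mem_Ioc] at hs; omega
  have ht1 : 1 ≤ t := by have := ht.1; omega
  have hJ1 : ∀ s ∈ J, 1 ≤ s := fun s hs => hI1 s (hJ hs)
  obtain ⟨hZi, hZ⟩ := henv.integral_norm_score_sq_le hS hp hI1
  have hcardK : ∀ s X u, (exploitRule N d κ sel s X u).card ≤ K := fun s X u => by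
    simpa [assortments, exploitRule] using
      hsel.feasible (optScore (alpha N d κ (episode s)) X u)
  obtain ⟨hQi, hQ⟩ := henv.integral_gramDevSq_le hS hp hJ1
    (Z := exploitRule N d κ sel) (U := fun s => episodeData x S θhat (episode s))
    (fun s A => measurableSet_sel_optScore hsel _ A) hcardK
    (fun s hs => halg.measurable_episodeData hd (hJe s hs).1)
    (fun s hs => halg.ae_eq_sel hd (hJe s hs))
  set Q := gramDevSq p x S (exploitRule N d κ sel)
    (fun s => episodeData x S θhat (episode s)) J with hQdef
  set Zs := fun ω => ‖score (fun t => x t ω) (fun t => S t ω) (fun t => c t ω) I θstar‖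
    with hZs
  have hQ0 : ∀ ω, 0 ≤ Q ω := fun ω =>
    Finset.sum_nonneg fun a _ => Finset.sum_nonneg fun b _ => sq_nonneg _
  -- Coefficients of a pointwise majorant of the regret. If `Q > (e L)²` or `Zs ≥ κ e L`, then `A₁ *
  -- Q` or the first part of `A₂ * Zs²` is at least the trivial bound `2`. Otherwise the MLE bound
  -- applies, with `Zs` linearized at its typical scale `√L`; this produces the second part of `A₂`
  -- and the first of `A₃`.
  set A₁ := 2 / (e * L) ^ 2 with hA₁
  set A₂ := 2 / (κ * (e * L)) ^ 2 + 2 / (κ * (e * L) * Real.sqrt L) with hA₂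
  set A₃ := 2 * Real.sqrt L / (κ * (e * L)) + 2 * α / Real.sqrt (e * L) with hA₃
  have hsL : 0 < Real.sqrt L := Real.sqrt_pos.2 hL0
  have hpt : ∀ᵐ ω ∂P, roundRegret K r θstar x S t ω ≤ A₁ * Q ω + A₂ * Zs ω ^ 2 + A₃ := by
    have hJS := (Filter.eventually_all_finset J).2 fun s hs => halg.ae_eq_sel hd (hJe s hs)
    have hJc := (Filter.eventually_all_finset J).2 fun s hs =>
      henv.ae_choiceProb_bound hcp (hJ1 s hs)
    filter_upwards [halg.ae_eq_sel hd ht, henv.ae_norm_le_one hp ht1, hJS, hJc,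
      halg.estimate (episode t) (two_le_episode (by have := ht.1; omega))]
      with ω hSt hx hSJ hcJ hest
    have hA₁0 : 0 ≤ A₁ * Q ω := mul_nonneg (by positivity) (hQ0 ω)
    have hA₂0 : 0 ≤ A₂ * Zs ω ^ 2 := by positivity
    have hA₃0 : 0 ≤ A₃ := by positivity
    have h2 := (le_abs_self _).trans (abs_roundRegret_le (K := K) (θstar := θstar) (x := x)
      (S := S) hr t ω)
    by_cases hQω : Q ω ≤ (e * L) ^ 2
    · by_cases hZω : Zs ω < κ * (e * L)
      · have hgram : ∀ v : Vec d, e * L * ‖v‖ ^ 2 ≤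
            ∑ t ∈ J, ∑ i ∈ S t ω, utility (x t ω) v i ^ 2 := by
          intro v
          refine le_trans (mul_le_mul_of_nonneg_right ?_ (sq_nonneg _))
            (gram_ge_of_gramDevSq_le (q := e * L) (lam := K * σ₀) (M := M') (by positivity)
              hM' (fun s _ v => mul_norm_sq_le_expectedGram hM hMM' hp hKN hκ hr0 hsel s ω v)
              hQω v)
          rw [hJL]
          have h3 : (K : ℝ) * σ₀ / M' = 2 * e * K := by rw [he_def]; field_simp
          have h4 : (1 : ℝ) ≤ K := by exact_mod_cast hK
          have h5 : 0 < e * L := by positivity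
          rw [h3]
          nlinarith
        have h := roundRegret_le_of_gram_ge hr hsel hκ (lam := e * L) (by positivity) hJ hx hSt
          hest (fun s hs i hi θ hθ => by
            have hf : S s ω ∈ assortments N K := by rw [hSJ s hs]; exact hsel.feasible _
            exact hcJ s hs _ hf i hi θ hθ) hgram hZω
        refine h.trans ?_
        change 2 * (Zs ω / (κ * (e * L)) + α / Real.sqrt (e * L)) ≤ _
        have h3 : 2 * (Zs ω / (κ * (e * L))) ≤
            2 / (κ * (e * L) * Real.sqrt L) * Zs ω ^ 2 + 2 * Real.sqrt L / (κ * (e * L)) := by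
          have h4 := le_add_sq_div (a := Zs ω) hsL
          calc 2 * (Zs ω / (κ * (e * L))) ≤
              2 * ((Real.sqrt L + Zs ω ^ 2 / Real.sqrt L) / (κ * (e * L))) := by gcongr
            _ = _ := by field_simp; ring
        have h5 : 0 ≤ 2 / (κ * (e * L)) ^ 2 * Zs ω ^ 2 := by positivity
        have h6 : 2 * (α / Real.sqrt (e * L)) = 2 * α / Real.sqrt (e * L) := by ring
        have h7 : A₂ * Zs ω ^ 2 = 2 / (κ * (e * L)) ^ 2 * Zs ω ^ 2 +
            2 / (κ * (e * L) * Real.sqrt L) * Zs ω ^ 2 := by rw [hA₂]; ring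
        linarith
      · have h3 : 2 ≤ 2 / (κ * (e * L)) ^ 2 * Zs ω ^ 2 := by
          rw [div_mul_eq_mul_div, le_div_iff₀ (by positivity)]
          have := pow_le_pow_left₀ (by positivity) (not_lt.1 hZω) 2
          linarith
        have h4 : 2 / (κ * (e * L)) ^ 2 * Zs ω ^ 2 ≤ A₂ * Zs ω ^ 2 :=
          mul_le_mul_of_nonneg_right (le_add_of_nonneg_right (by positivity)) (sq_nonneg _)
        linarith
    · have h3 : 2 ≤ A₁ * Q ω := by
        rw [hA₁, div_mul_eq_mul_div, le_div_iff₀ (by positivity)]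
        linarith [not_le.1 hQω]
      linarith
  have hZi' : Integrable (fun ω => Zs ω ^ 2) P := hZi
  have hZ' : ∫ ω, Zs ω ^ 2 ∂P ≤ 8 * d * L := by
    refine le_trans hZ ?_
    have : (I.card : ℝ) ≤ 2 * L := by exact_mod_cast hIL
    calc (4 : ℝ) * d * I.card ≤ 4 * d * (2 * L) := by gcongr
      _ = 8 * d * L := by ring
  rw [hJL] at hQ
  have hsq : Real.sqrt L * Real.sqrt L = L := Real.mul_self_sqrt hL0.le
  have h1L : 1 / (L : ℝ) ≤ 1 / Real.sqrt L := by
    refine one_div_le_one_div_of_le hsL ?_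
    have : 1 ≤ Real.sqrt L := Real.one_le_sqrt.2 (by exact_mod_cast hL)
    nlinarith
  have hse : 0 < Real.sqrt e := Real.sqrt_pos.2 he
  have hi1 : Integrable (fun ω => A₁ * Q ω) P := hQi.const_mul _
  have hi2 : Integrable (fun ω => A₂ * Zs ω ^ 2) P := hZi'.const_mul _
  have hi3 : Integrable (fun ω => A₁ * Q ω + A₂ * Zs ω ^ 2) P := hi1.add hi2
  calc ∫ ω, roundRegret K r θstar x S t ω ∂P
      ≤ ∫ ω, (A₁ * Q ω + A₂ * Zs ω ^ 2 + A₃) ∂P :=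
        integral_mono_ae (integrable_roundRegret henv hS hr t)
          (hi3.add (integrable_const _)) hpt
    _ = A₁ * ∫ ω, Q ω ∂P + A₂ * ∫ ω, Zs ω ^ 2 ∂P + A₃ := by
        rw [integral_add hi3 (integrable_const _), integral_add hi1 hi2, integral_const_mul,
          integral_const_mul]
        simp
    _ ≤ A₁ * (d ^ 2 * (L * (2 * K) ^ 2)) + A₂ * (8 * d * L) + A₃ := by gcongr
    _ = (8 * d ^ 2 * K ^ 2 / e ^ 2 + 16 * d / (κ * e) ^ 2) * (1 / L) +
        ((2 + 16 * d) / (κ * e) + 2 * α / Real.sqrt e) * (1 / Real.sqrt L) := by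
        rw [hA₁, hA₂, hA₃, Real.sqrt_mul he.le]
        generalize Real.sqrt L = s at *
        rw [← hsq]
        have hs0 : s ≠ 0 := hsL.ne'
        field_simp
        ring
    _ ≤ (8 * d ^ 2 * K ^ 2 / e ^ 2 + 16 * d / (κ * e) ^ 2) * (1 / Real.sqrt L) +
        ((2 + 16 * d) / (κ * e) + 2 * α / Real.sqrt e) * (1 / Real.sqrt L) := by gcongr
    _ = _ := by ring

end Expected

/-! ### Summation over the rounds -/

theorem sum_one_div_sqrt_le (T : ℕ) :
    ∑ t ∈ Finset.Icc 1 T, 1 / Real.sqrt t ≤ 2 * Real.sqrt T := by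
  induction T with
  | zero => simp
  | succ n ih =>
    rw [Finset.sum_Icc_succ_top (by omega)]
    have h1 : 0 < Real.sqrt ((n + 1 : ℕ) : ℝ) := Real.sqrt_pos.2 (by positivity)
    have h2 : Real.sqrt n ≤ Real.sqrt ((n + 1 : ℕ) : ℝ) :=
      Real.sqrt_le_sqrt (by push_cast; linarith)
    have h3 : Real.sqrt ((n + 1 : ℕ) : ℝ) ^ 2 = Real.sqrt n ^ 2 + 1 := by
      rw [Real.sq_sqrt (by positivity), Real.sq_sqrt (by positivity)]
      push_cast
      ring
    -- Each term is dominated by a telescoping difference.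
    have h4 : 1 / Real.sqrt ((n + 1 : ℕ) : ℝ) ≤
        2 * (Real.sqrt ((n + 1 : ℕ) : ℝ) - Real.sqrt n) := by
      rw [div_le_iff₀ h1]
      nlinarith
    linarith

theorem two_pow_clog_lt {t : ℕ} (ht : 2 ≤ t) : 2 ^ Nat.clog 2 t < 2 * t := by
  have h1 := Nat.clog_pos one_lt_two ht
  have h2 := Nat.pow_pred_clog_lt_self one_lt_two (x := t) (by omega)
  obtain ⟨m, hm⟩ : ∃ m, Nat.clog 2 t = m + 1 := ⟨Nat.clog 2 t - 1, by omega⟩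
  rw [hm] at h2 ⊢
  simp only [Nat.pred_eq_sub_one, Nat.add_sub_cancel] at h2
  rw [pow_succ]
  omega

theorem half_le_log_two : (1 / 2 : ℝ) ≤ Real.log 2 := by
  linarith [Real.log_two_gt_d9]

theorem half_le_log {T : ℕ} (hT : 2 ≤ T) : (1 / 2 : ℝ) ≤ Real.log T :=
  half_le_log_two.trans (Real.log_le_log two_pos (by exact_mod_cast hT))

/-- From `2 ^ clog ≤ 2 T` follows `clog * log 2 ≤ 2 log T`. Since `log 2 ≥ 1 / 2`, this gives `clog
≤ 4 log T` and `1 ≤ 2 log T`. -/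
theorem clog_add_one_le {T : ℕ} (hT : 2 ≤ T) : (Nat.clog 2 T + 1 : ℝ) ≤ 6 * Real.log T := by
  have h1 : ((2 : ℝ) ^ Nat.clog 2 T) ≤ 2 * T := by exact_mod_cast (two_pow_clog_lt hT).le
  have hT0 : (0 : ℝ) < T := by exact_mod_cast (by omega : 0 < T)
  have h2 := Real.log_le_log (by positivity) h1
  rw [Real.log_pow, Real.log_mul (by norm_num) hT0.ne'] at h2
  have h3 := half_le_log_two
  have h4 : Real.log 2 ≤ Real.log T := Real.log_le_log two_pos (by exact_mod_cast hT)
  have h5 : (0 : ℝ) ≤ Nat.clog 2 T := Nat.cast_nonneg' _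
  nlinarith

/-- The number of rounds at distance at most `q` from the end of their episode. -/
theorem card_late_le (T : ℕ) {q : ℝ} (hq : 0 ≤ q) :
    (((Finset.Icc 1 T).filter fun t => ((2 ^ Nat.clog 2 t : ℕ) : ℝ) - t ≤ q).card : ℝ) ≤
      (Nat.clog 2 T + 1) * (q + 1) := by
  -- Each episode end `2 ^ n` owns a window of at most `⌊q⌋₊ + 1` rounds; truncation of the
  -- subtraction at `0` only shortens it.
  have hsub : ((Finset.Icc 1 T).filter fun t => ((2 ^ Nat.clog 2 t : ℕ) : ℝ) - t ≤ q) ⊆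
      (Finset.range (Nat.clog 2 T + 1)).biUnion fun n =>
        Finset.Icc (2 ^ n - ⌊q⌋₊) (2 ^ n) := by
    intro t ht
    rw [Finset.mem_filter, Finset.mem_Icc] at ht
    obtain ⟨⟨-, htT⟩, htq⟩ := ht
    rw [Finset.mem_biUnion]
    have h1 : t ≤ 2 ^ Nat.clog 2 t := Nat.le_pow_clog one_lt_two t
    refine ⟨Nat.clog 2 t, Finset.mem_range.2 (Nat.lt_succ_of_le (Nat.clog_mono_right 2 htT)),
      Finset.mem_Icc.2 ⟨?_, h1⟩⟩
    have h2 : 2 ^ Nat.clog 2 t - t ≤ ⌊q⌋₊ := by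
      refine Nat.le_floor ?_
      rw [Nat.cast_sub h1]
      exact htq
    omega
  have h1 := (Finset.card_le_card hsub).trans (Finset.card_biUnion_le_card_mul _ _ (⌊q⌋₊ + 1)
    fun n _ => by rw [Nat.card_Icc]; omega)
  rw [Finset.card_range] at h1
  calc _ ≤ (((Nat.clog 2 T + 1) * (⌊q⌋₊ + 1) : ℕ) : ℝ) := by exact_mod_cast h1
    _ ≤ _ := by
      push_cast
      gcongr
      exact Nat.floor_le hq

theorem card_early_le (T : ℕ) {q : ℝ} (hq : 0 ≤ q) :
    (((Finset.Icc 1 T).filter fun t : ℕ => (t : ℝ) ≤ q).card : ℝ) ≤ q := by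
  have hsub : ((Finset.Icc 1 T).filter fun t : ℕ => (t : ℝ) ≤ q) ⊆ Finset.Icc 1 ⌊q⌋₊ := by
    intro t ht
    rw [Finset.mem_filter, Finset.mem_Icc] at ht
    exact Finset.mem_Icc.2 ⟨ht.1.1, Nat.le_floor ht.2⟩
  have h := Finset.card_le_card hsub
  rw [Nat.card_Icc, Nat.add_sub_cancel] at h
  exact (by exact_mod_cast h : (_ : ℝ) ≤ (⌊q⌋₊ : ℝ)).trans (Nat.floor_le hq)

/-- Rounds near the end of an episode and the first `C₂ * l` rounds are charged `2` each; the
remaining ones sum like `√l * ∑ 1 / √t`. Here `l` stands for `log (T N)`. -/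
theorem sum_le_of_round_bound {f : ℕ → ℝ} {T : ℕ} {l C₁ C₂ C₃ : ℝ} (hT : 2 ≤ T) (hl : 1 / 2 ≤ l)
    (hC₁ : 0 ≤ C₁) (hC₂ : 0 ≤ C₂) (hC₃ : 0 ≤ C₃) (hf : ∀ t, f t ≤ 2)
    (hbound : ∀ t ∈ Finset.Icc 1 T, C₁ * l < ((2 ^ Nat.clog 2 t : ℕ) : ℝ) - t → C₂ * l < t →
      f t ≤ C₃ * Real.sqrt l * (1 / Real.sqrt t)) :
    ∑ t ∈ Finset.Icc 1 T, f t ≤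
      (28 + 12 * C₁ + 4 * C₂ + 4 * C₃) * (Real.log T * Real.sqrt (T * l)) := by
  have hlog := half_le_log hT
  have hT0 : (0 : ℝ) < T := by exact_mod_cast (by omega : 0 < T)
  have hl0 : 0 < l := by linarith
  set w := Real.sqrt (T * l) with hw
  have hw0 : 0 ≤ w := Real.sqrt_nonneg _
  have hwl : w ≤ 2 * (Real.log T * w) := by nlinarith
  have hlw0 : 0 ≤ Real.log T * w := by positivity
  -- If `l ≤ T`, then `l ≤ √(T l)` and the logarithmic counts are affordable; otherwise `T ≤ √(T l)`
  -- and the trivial bound `2 T` suffices.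
  rcases le_or_gt l T with hlT | hTl
  · have hlw : l ≤ w := Real.le_sqrt_of_sq_le (by nlinarith)
    have hpt : ∀ t ∈ Finset.Icc 1 T, f t ≤
        ((if (t : ℝ) ≤ C₂ * l then 2 else 0) +
          (if ((2 ^ Nat.clog 2 t : ℕ) : ℝ) - t ≤ C₁ * l then 2 else 0)) +
          C₃ * Real.sqrt l * (1 / Real.sqrt t) := by
      intro t ht
      have h0 : 0 ≤ C₃ * Real.sqrt l * (1 / Real.sqrt t) := by positivity
      have h2 := hf t
      by_cases h3 : (t : ℝ) ≤ C₂ * l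
      · rw [if_pos h3]
        split_ifs <;> linarith
      · by_cases h4 : ((2 ^ Nat.clog 2 t : ℕ) : ℝ) - t ≤ C₁ * l
        · rw [if_neg h3, if_pos h4]
          linarith
        · rw [if_neg h3, if_neg h4]
          linarith [hbound t ht (not_le.1 h4) (not_le.1 h3)]
    refine (Finset.sum_le_sum hpt).trans ?_
    rw [Finset.sum_add_distrib, Finset.sum_add_distrib, ← Finset.mul_sum, ← Finset.sum_filter,
      ← Finset.sum_filter, Finset.sum_const, Finset.sum_const, nsmul_eq_mul, nsmul_eq_mul]
    have h1 := card_early_le T (q := C₂ * l) (by positivity)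
    have h2 := card_late_le T (q := C₁ * l) (by positivity)
    have h3 := mul_le_mul_of_nonneg_left (sum_one_div_sqrt_le T)
      (by positivity : 0 ≤ C₃ * Real.sqrt l)
    have h4 : C₃ * Real.sqrt l * (2 * Real.sqrt T) = 2 * C₃ * w := by
      rw [hw, Real.sqrt_mul hT0.le]
      ring
    have h5 : (Nat.clog 2 T + 1 : ℝ) * (C₁ * l + 1) ≤ 6 * Real.log T * ((C₁ + 2) * w) := by
      refine mul_le_mul (clog_add_one_le hT) ?_ (by positivity) (by positivity)
      nlinarith
    have h6 : C₂ * l ≤ C₂ * w := mul_le_mul_of_nonneg_left hlw hC₂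
    have h7 : C₂ * w ≤ C₂ * (2 * (Real.log T * w)) := mul_le_mul_of_nonneg_left hwl hC₂
    have h8 : C₃ * w ≤ C₃ * (2 * (Real.log T * w)) := mul_le_mul_of_nonneg_left hwl hC₃
    linarith
  · have hTw : (T : ℝ) ≤ w := Real.le_sqrt_of_sq_le (by nlinarith)
    have h1 : ∑ t ∈ Finset.Icc 1 T, f t ≤ T * 2 := by
      simpa using Finset.sum_le_card_nsmul (Finset.Icc 1 T) f 2 fun t _ => hf t
    have h2 : 0 ≤ (12 * C₁ + 4 * C₂ + 4 * C₃) * (Real.log T * w) := by positivity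
    linarith

/-! ### Parameters of the algorithm -/

section Parameters

variable {N d K : ℕ} {κ σ₀ : ℝ}

theorem tau_episode {t : ℕ} (ht : 2 ≤ t) : tau d (episode t) = 2 ^ Nat.clog 2 t := by
  have h1 := Nat.clog_pos one_lt_two ht
  unfold tau episode
  rw [if_neg (by omega), if_neg (by omega), Nat.add_sub_cancel]

/-- The episode of `t` ends between `t` and `2 t`, so `2 ≤ τ ≤ 2 T`; the divisor `4` keeps the
logarithm nonnegative and cancels the factor `2`. -/
theorem log_tau_le (hN : 1 ≤ N) {t T : ℕ} (ht : 2 ≤ t) (htT : t ≤ T) :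
    0 ≤ Real.log ((tau d (episode t) : ℝ) ^ 2 * N / 4) ∧
      Real.log ((tau d (episode t) : ℝ) ^ 2 * N / 4) ≤ 2 * Real.log ((T : ℝ) * N) := by
  have htau : tau d (episode t) = 2 ^ Nat.clog 2 t := tau_episode ht
  have h2 : (2 : ℝ) ≤ tau d (episode t) := by
    have : t ≤ 2 ^ Nat.clog 2 t := Nat.le_pow_clog one_lt_two t
    rw [htau]
    exact_mod_cast ht.trans this
  have h3 : (tau d (episode t) : ℝ) ≤ 2 * T := by
    have := two_pow_clog_lt ht
    rw [htau]
    exact_mod_cast (by omega : 2 ^ Nat.clog 2 t ≤ 2 * T)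
  have hN' : (1 : ℝ) ≤ N := by exact_mod_cast hN
  constructor
  · refine Real.log_nonneg ?_
    nlinarith
  · have h4 : (2 : ℝ) * Real.log ((T : ℝ) * N) = Real.log (((T : ℝ) * N) ^ 2) := by
      rw [Real.log_pow]
      norm_num
    rw [h4]
    refine Real.log_le_log (by positivity) ?_
    have h5 : (tau d (episode t) : ℝ) ^ 2 ≤ (2 * T) ^ 2 := pow_le_pow_left₀ (by linarith) h3 2
    have h6 : (N : ℝ) ≤ N ^ 2 := by nlinarith
    calc (tau d (episode t) : ℝ) ^ 2 * N / 4 ≤ (2 * T) ^ 2 * N ^ 2 / 4 := by gcongr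
      _ = _ := by ring

theorem alpha_le (hκ : 0 < κ) (hN : 1 ≤ N) {t T : ℕ} (ht : 2 ≤ t) (htT : t ≤ T) :
    alpha N d κ (episode t) ≤ 10 / κ * Real.sqrt (Real.log ((T : ℝ) * N)) := by
  have h := (log_tau_le (d := d) hN ht htT).2
  have h0 := (log_tau_le (d := d) hN ht htT).1
  have h1 : Real.sqrt (Real.log ((tau d (episode t) : ℝ) ^ 2 * N / 4)) ≤
      2 * Real.sqrt (Real.log ((T : ℝ) * N)) := by
    rw [Real.sqrt_le_left (by positivity), mul_pow, Real.sq_sqrt (by linarith)]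
    linarith
  unfold alpha
  calc 5 / κ * Real.sqrt (Real.log ((tau d (episode t) : ℝ) ^ 2 * N / 4)) ≤
      5 / κ * (2 * Real.sqrt (Real.log ((T : ℝ) * N))) := by gcongr
    _ = _ := by ring

/-- The term `4 d²` is at most `4 / σ₀²`, and `log (T N) ≥ 1 / 2` absorbs this constant into the
logarithm. -/
theorem qParam_le (hκ : 0 < κ) (hσ₀ : 0 < σ₀) (hdσ : d * σ₀ ≤ 1) (hK : 1 ≤ K) (hN : 1 ≤ N)
    {t T : ℕ} (ht : 2 ≤ t) (htT : t ≤ T) :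
    qParam N d K κ σ₀ (episode t) ≤
      288 / (σ₀ * κ ^ 4) * (8 / σ₀ ^ 2 + 2) * Real.log ((T : ℝ) * N) := by
  obtain ⟨h0, h⟩ := log_tau_le (d := d) hN ht htT
  have hK' : (1 : ℝ) ≤ K := by exact_mod_cast hK
  have hN' : (1 : ℝ) ≤ N := by exact_mod_cast hN
  have hl : 1 / 2 ≤ Real.log ((T : ℝ) * N) := by
    have hT0 : (0 : ℝ) < T := by exact_mod_cast (by omega : 0 < T)
    refine (half_le_log (T := T) (by omega)).trans (Real.log_le_log hT0 ?_)
    nlinarith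
  have h1 : (d : ℝ) ^ 2 ≤ 1 / σ₀ ^ 2 := by
    rw [le_div_iff₀ (by positivity), ← mul_pow]
    exact pow_le_one₀ (by positivity) hdσ
  have h2 : 288 / (K * σ₀ * κ ^ 4) ≤ 288 / (σ₀ * κ ^ 4) := by
    refine div_le_div_of_nonneg_left (by norm_num) (by positivity) ?_
    rw [mul_assoc]
    exact le_mul_of_one_le_left (by positivity) hK'
  unfold qParam
  rw [mul_assoc (288 / (σ₀ * κ ^ 4))]
  refine mul_le_mul h2 ?_ (by positivity) (by positivity)
  have h3 : 4 / σ₀ ^ 2 ≤ 8 / σ₀ ^ 2 * Real.log ((T : ℝ) * N) := by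
    have : 0 ≤ 8 / σ₀ ^ 2 := by positivity
    calc 4 / σ₀ ^ 2 = 8 / σ₀ ^ 2 * (1 / 2) := by ring
      _ ≤ _ := mul_le_mul_of_nonneg_left hl this
  have h4 : 4 * (1 / σ₀ ^ 2) = 4 / σ₀ ^ 2 := by ring
  linarith

theorem isExploitRound_of_lt (hκ : 0 < κ) (hσ₀ : 0 < σ₀) (hdσ : d * σ₀ ≤ 1) (hd : 1 ≤ d)
    (hK : 1 ≤ K) (hN : 1 ≤ N) {t T : ℕ} (ht : d < t) (htT : t ≤ T)
    (h : 288 / (σ₀ * κ ^ 4) * (8 / σ₀ ^ 2 + 2) * Real.log ((T : ℝ) * N) <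
      ((2 ^ Nat.clog 2 t : ℕ) : ℝ) - t) : IsExploitRound N d K κ σ₀ t := by
  refine ⟨ht, ?_⟩
  rw [tau_episode (by omega)]
  exact (qParam_le hκ hσ₀ hdσ hK hN (by omega) htT).trans_lt h

end Parameters

/-! ### The regret bound -/

/-- Constant in the bound `lateConst * log (T N)` on the lengths of the exploration phases. -/
def lateConst (κ σ₀ : ℝ) : ℝ := 288 / (σ₀ * κ ^ 4) * (8 / σ₀ ^ 2 + 2)

/-- Constant in the bound on the expected regret of a round without exploration. -/
def roundConst (κ σ₀ M : ℝ) : ℝ :=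
  3 * (2 * (8 * (1 / σ₀) ^ 2 * (18 / κ ^ 4) ^ 2 / (σ₀ / (2 * M)) ^ 2 +
    16 * (1 / σ₀) / (κ * (σ₀ / (2 * M))) ^ 2 +
    (2 + 16 * (1 / σ₀)) / (κ * (σ₀ / (2 * M)))) + 20 / κ / Real.sqrt (σ₀ / (2 * M)))

/-- Constant in the regret bound. -/
def regretConst (κ σ₀ M : ℝ) : ℝ :=
  (28 + 12 * lateConst κ σ₀ + 4 * (8 * lateConst κ σ₀ + 8 * (1 / σ₀) + 10) +
    4 * roundConst κ σ₀ M) * Real.sqrt (1 + 1 / σ₀ * (1 / σ₀ + 1))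

theorem lateConst_nonneg {κ σ₀ : ℝ} (hσ₀ : 0 < σ₀) : 0 ≤ lateConst κ σ₀ := by
  unfold lateConst
  positivity

theorem roundConst_nonneg {κ σ₀ M : ℝ} (hκ : 0 < κ) (hσ₀ : 0 < σ₀) (hM : 0 < M) :
    0 ≤ roundConst κ σ₀ M := by
  unfold roundConst
  positivity

/-- The dimension is bounded, so that `log T` and `d * log (T / d)` are comparable. -/
theorem log_le_mul_log_div {d T : ℕ} (hd : 1 ≤ d) (hdT : d < T) {D : ℝ} (hD : d ≤ D) :
    Real.log T ≤ (1 + D * (D + 1)) * (d * Real.log ((T : ℝ) / d)) := by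
  have hd1 : (1 : ℝ) ≤ d := by exact_mod_cast hd
  have hd0 : (0 : ℝ) < d := by linarith
  have hdT' : (d : ℝ) + 1 ≤ T := by exact_mod_cast hdT
  have hT0 : (0 : ℝ) < T := by linarith
  -- Since `T ≥ d + 1`, `log (T / d) ≥ 1 - d / T ≥ 1 / (d + 1)`. Hence `log d ≤ d` is at most `d (d
  -- + 1) log (T / d)`.
  have h1 : 1 / ((d : ℝ) + 1) ≤ Real.log ((T : ℝ) / d) := by
    have h2 := Real.one_sub_inv_le_log_of_pos (x := (T : ℝ) / d) (by positivity)
    refine le_trans ?_ h2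
    rw [inv_div, div_le_iff₀ (by positivity)]
    have h3 : (d : ℝ) / T ≤ d / (d + 1) := by gcongr
    have h4 : (1 - (d : ℝ) / (d + 1)) * (d + 1) = 1 := by field_simp; ring
    nlinarith
  have h5 : 1 ≤ Real.log ((T : ℝ) / d) * (d + 1) := by rwa [div_le_iff₀ (by positivity)] at h1
  have h6 : Real.log T = Real.log ((T : ℝ) / d) + Real.log d := by
    rw [Real.log_div hT0.ne' hd0.ne']
    ring
  have h7 : Real.log d ≤ d := (Real.log_le_sub_one_of_pos hd0).trans (by linarith)
  have hl0 : 0 < Real.log ((T : ℝ) / d) := lt_of_lt_of_le (by positivity) h1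
  have h8 : (d : ℝ) ≤ d * (Real.log ((T : ℝ) / d) * (d + 1)) := le_mul_of_one_le_right hd0.le h5
  calc Real.log T ≤ (1 + d * (d + 1)) * Real.log ((T : ℝ) / d) := by nlinarith
    _ ≤ (1 + D * (D + 1)) * (d * Real.log ((T : ℝ) / d)) := by
      refine mul_le_mul ?_ (le_mul_of_one_le_left hl0.le hd1) hl0.le (by nlinarith)
      nlinarith

section Main

variable {Ω : Type*} {N d K : ℕ} {κ σ₀ : ℝ} {x : ℕ → Ω → Fin N → Vec d}
  {S : ℕ → Ω → Finset (Fin N)} {c : ℕ → Ω → Option (Fin N)} {θhat : ℕ → Ω → Vec d}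
  {p : Measure (Vec d)} {r : ℝ} {θstar : Vec d} {sel : (Fin N → ℝ) → Finset (Fin N)}
  [m0 : MeasurableSpace Ω] {P : Measure Ω} [IsProbabilityMeasure P]

theorem integrable_regret (henv : IsEnvironment P p θstar x S c)
    (hS : ∀ t A, MeasurableSet (S t ⁻¹' {A})) (hr : |r| ≤ 1) (T : ℕ) :
    Integrable (regret K (fun _ => r) θstar x S T) P :=
  integrable_finsetSum _ fun t _ => integrable_roundRegret henv hS hr t

variable [IsProbabilityMeasure p]

/-- With `4 L < t ≤ 8 L` the previous episode is `(2 L, 4 L]`. Its first half is at distance at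
least `L` from its end and so consists of exploitation rounds once `L` exceeds the exploration
length. As `l ≥ 1 / 2`, the three terms in `hbig` yield `lateConst * l < L`, `4 d < t` and `5 < t`.
-/
theorem IsDBLMNL.integral_roundRegret_le_of_late (halg : IsDBLMNL P K κ σ₀ sel x S c θhat)
    (henv : IsEnvironment P p θstar x S c) (hp : BoundedContexts p σ₀)
    (hcp : ChoiceProbBound N K p θstar κ) (hsel : IsArgmaxRule K (fun _ => r) sel)
    {M M' : ℝ} (hM : DiversityConstant N K p M) (hMM' : M ≤ M') (hM' : 0 < M')
    (hκ : 0 < κ) (hσ₀ : 0 < σ₀) (hd : 1 ≤ d) (hK : 1 ≤ K) (hKN : K ≤ N)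
    (hKκ : (K : ℝ) ≤ 18 / κ ^ 4) (hr : |r| ≤ 1) {t T : ℕ} (htT : t ≤ T)
    (hlate : lateConst κ σ₀ * Real.log ((T : ℝ) * N) < ((2 ^ Nat.clog 2 t : ℕ) : ℝ) - t)
    (hbig : (8 * lateConst κ σ₀ + 8 * (1 / σ₀) + 10) * Real.log ((T : ℝ) * N) < t) :
    ∫ ω, roundRegret K r θstar x S t ω ∂P ≤
      roundConst κ σ₀ M' * Real.sqrt (Real.log ((T : ℝ) * N)) * (1 / Real.sqrt t) := by
  have hN : 1 ≤ N := hK.trans hKN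
  have hdσ := hp.dim_mul_le_one
  have hdD : (d : ℝ) ≤ 1 / σ₀ := by rwa [le_div_iff₀ hσ₀]
  have hC := lateConst_nonneg (κ := κ) hσ₀
  have hRC := roundConst_nonneg hκ hσ₀ hM'
  set l := Real.log ((T : ℝ) * N) with hl_def
  have hl : 1 / 2 ≤ l := by
    have hN' : (1 : ℝ) ≤ N := by exact_mod_cast hN
    have hl0 : 0 ≤ l := by
      rcases Nat.eq_zero_or_pos T with h | h
      · simp [hl_def, h]
      · have : (1 : ℝ) ≤ T := by exact_mod_cast h
        exact Real.log_nonneg (by nlinarith)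
    have ht0 : 0 < t := by
      have : (0 : ℝ) < t := lt_of_le_of_lt (by positivity) hbig
      exact_mod_cast this
    -- For `T = 1` the only round ends its own episode, contradicting `hlate`.
    have hT2 : 2 ≤ T := by
      by_contra hcon
      have ht1 : t = 1 := by omega
      rw [ht1] at hlate
      norm_num at hlate
      have := mul_nonneg hC hl0
      linarith
    have hT0 : (0 : ℝ) < T := by exact_mod_cast (by omega : 0 < T)
    exact (half_le_log hT2).trans (Real.log_le_log hT0 (by nlinarith))
  have hl0 : 0 < l := by linarith
  have h1σ : 0 < 1 / σ₀ := by positivity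
  have ht5 : 5 < t := by
    have : (5 : ℝ) < t := by nlinarith [mul_nonneg hC hl0.le, mul_pos h1σ hl0]
    exact_mod_cast this
  have h4d : 4 * d < t := by
    have : (4 * d : ℝ) < t := by nlinarith [mul_nonneg hC hl0.le]
    exact_mod_cast this
  have hex : IsExploitRound N d K κ σ₀ t :=
    isExploitRound_of_lt hκ hσ₀ hdσ hd hK hN (by omega) htT hlate
  rcases le_or_gt r 0 with hr0 | hr0
  · exact (halg.integral_roundRegret_nonpos hsel hd hr0 hex).trans (by positivity)
  -- As `t > 4`, the two preceding boundaries are genuine powers of two rather than the special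
  -- values `0` and `d`.
  obtain ⟨m, hm⟩ : ∃ m, Nat.clog 2 t = m + 3 := by
    have : 2 < Nat.clog 2 t := (Nat.lt_clog_iff_pow_lt one_lt_two).2 (by omega)
    exact ⟨Nat.clog 2 t - 3, by omega⟩
  set L := 2 ^ m with hL_def
  have hL1 : 1 ≤ L := Nat.one_le_two_pow
  have e1 : 2 ^ (m + 1) = 2 * L := by rw [hL_def, pow_succ]; ring
  have e2 : 2 ^ (m + 2) = 4 * L := by rw [pow_succ, e1]; ring
  have e3 : 2 ^ (m + 3) = 8 * L := by rw [pow_succ, e2]; ring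
  have ht8 : t ≤ 8 * L := by rw [← e3, ← hm]; exact Nat.le_pow_clog one_lt_two t
  have hep : episode t = m + 4 := by rw [episode, hm]
  have htau1 : tau d (episode t - 1) = 4 * L := by
    rw [hep, tau, if_neg (by omega), if_neg (by omega), ← e2]
    congr 1
  have htau2 : tau d (episode t - 2) = 2 * L := by
    rw [hep, tau, if_neg (by omega), if_neg (by omega), ← e1]
    congr 1
  have ht8' : (t : ℝ) ≤ 8 * L := by exact_mod_cast ht8
  have hLC : lateConst κ σ₀ * l < L := by nlinarith [mul_nonneg hC hl0.le, mul_pos h1σ hl0]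
  have hJe : ∀ s ∈ Finset.Ioc (2 * L) (3 * L), IsExploitRound N d K κ σ₀ s := by
    intro s hs
    rw [Finset.mem_Ioc] at hs
    have hclog : Nat.clog 2 s = m + 2 := by
      refine le_antisymm (Nat.clog_le_of_le_pow (by omega)) ?_
      exact (Nat.lt_clog_iff_pow_lt one_lt_two).2 (by omega)
    have hsT : s ≤ T := by
      have : 2 ^ (m + 2) < t := (Nat.lt_clog_iff_pow_lt one_lt_two).1 (by omega)
      omega
    refine isExploitRound_of_lt hκ hσ₀ hdσ hd hK hN (by omega) hsT (lt_of_lt_of_le hLC ?_)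
    rw [hclog, e2]
    have : (s : ℝ) ≤ 3 * L := by exact_mod_cast hs.2
    push_cast
    linarith
  have h := halg.integral_roundRegret_le henv hp hcp hsel hM hMM' hM' hκ hσ₀ hd hK hKN hr0 hr
    hL1 (J := Finset.Ioc (2 * L) (3 * L)) hex
    (by rw [htau1, htau2]; exact Finset.Ioc_subset_Ioc_right (by omega)) hJe
    (by rw [Nat.card_Ioc]; omega) (by rw [htau1, htau2, Nat.card_Ioc]; omega)
  refine h.trans ?_
  set e := σ₀ / (2 * M') with he_def
  have he : 0 < e := by positivity
  have hα := alpha_le (d := d) hκ hN (t := t) (by omega) htT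
  rw [← hl_def] at hα
  have hsl : 1 ≤ 2 * Real.sqrt l := by
    have h2 : Real.sqrt l ^ 2 = l := Real.sq_sqrt hl0.le
    nlinarith [Real.sqrt_nonneg l]
  have ht0 : (0 : ℝ) < t := by exact_mod_cast (by omega : 0 < t)
  -- The factor `3` comes from `t ≤ 8 L ≤ 9 L`.
  have hLt : 1 / Real.sqrt L ≤ 3 * (1 / Real.sqrt t) := by
    have hst : 0 < Real.sqrt t := Real.sqrt_pos.2 ht0
    have hsL : 0 < Real.sqrt L := Real.sqrt_pos.2 (by positivity)
    have h3 : Real.sqrt t ≤ 3 * Real.sqrt L := by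
      rw [Real.sqrt_le_left (by positivity), mul_pow, Real.sq_sqrt (by positivity)]
      linarith [(Nat.cast_nonneg' L : (0 : ℝ) ≤ L)]
    rw [mul_one_div, div_le_div_iff₀ hsL hst]
    linarith
  set A := 8 * (1 / σ₀) ^ 2 * (18 / κ ^ 4) ^ 2 / e ^ 2 + 16 * (1 / σ₀) / (κ * e) ^ 2 +
    (2 + 16 * (1 / σ₀)) / (κ * e) with hA
  have hA0 : 0 ≤ A := by positivity
  have hse : 0 < Real.sqrt e := Real.sqrt_pos.2 he
  have hst0 : 0 ≤ 1 / Real.sqrt (t : ℝ) := by positivity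
  rw [div_eq_mul_one_div]
  -- Here `d` and `K` are replaced by their bounds `1 / σ₀` and `18 / κ ^ 4`.
  calc _ ≤ (A + 2 * (10 / κ * Real.sqrt l) / Real.sqrt e) * (3 * (1 / Real.sqrt t)) := by
        rw [hA]
        gcongr
    _ ≤ (A * (2 * Real.sqrt l) + 2 * (10 / κ * Real.sqrt l) / Real.sqrt e) *
        (3 * (1 / Real.sqrt t)) := by
        gcongr
        exact le_mul_of_one_le_right hA0 hsl
    _ = roundConst κ σ₀ M' * Real.sqrt l * (1 / Real.sqrt t) := by
        rw [roundConst, ← he_def, ← hA]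
        ring

theorem IsDBLMNL.integral_regret_le (halg : IsDBLMNL P K κ σ₀ sel x S c θhat)
    (henv : IsEnvironment P p θstar x S c) (hp : BoundedContexts p σ₀)
    (hcp : ChoiceProbBound N K p θstar κ) (hsel : IsArgmaxRule K (fun _ => r) sel)
    {M M' : ℝ} (hM : DiversityConstant N K p M) (hMM' : M ≤ M') (hM' : 0 < M')
    (hκ : 0 < κ) (hσ₀ : 0 < σ₀) (hd : 1 ≤ d) (hK : 1 ≤ K) (hKN : K ≤ N)
    (hKκ : (K : ℝ) ≤ 18 / κ ^ 4) (hr : |r| ≤ 1) {T : ℕ} (hT : d < T) :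
    ∫ ω, regret K (fun _ => r) θstar x S T ω ∂P ≤
      regretConst κ σ₀ M' * Real.sqrt (d * T * Real.log ((T : ℝ) / d) *
        Real.log ((T : ℝ) * N) * Real.log T) := by
  have hS := halg.measurable_assortment
  have hT2 : 2 ≤ T := by omega
  have hT0 : (0 : ℝ) < T := by exact_mod_cast (by omega : 0 < T)
  have hdD : (d : ℝ) ≤ 1 / σ₀ := by rw [le_div_iff₀ hσ₀]; exact hp.dim_mul_le_one
  have hN' : (1 : ℝ) ≤ N := by exact_mod_cast hK.trans hKN
  have hlog := half_le_log hT2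
  have hl : 1 / 2 ≤ Real.log ((T : ℝ) * N) :=
    hlog.trans (Real.log_le_log hT0 (by nlinarith))
  have hC := lateConst_nonneg (κ := κ) hσ₀
  have hRC := roundConst_nonneg hκ hσ₀ hM'
  have h1 : ∫ ω, regret K (fun _ => r) θstar x S T ω ∂P =
      ∑ t ∈ Finset.Icc 1 T, ∫ ω, roundRegret K r θstar x S t ω ∂P :=
    integral_finsetSum _ fun t _ => integrable_roundRegret henv hS hr t
  have h2 : ∀ t, ∫ ω, roundRegret K r θstar x S t ω ∂P ≤ 2 := fun t => by
    calc ∫ ω, roundRegret K r θstar x S t ω ∂P ≤ ∫ _ω, (2 : ℝ) ∂P :=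
          integral_mono (integrable_roundRegret henv hS hr t) (integrable_const _)
            fun ω => (le_abs_self _).trans (abs_roundRegret_le hr t ω)
      _ = 2 := by simp
  rw [h1]
  refine (sum_le_of_round_bound hT2 hl hC (C₂ := 8 * lateConst κ σ₀ + 8 * (1 / σ₀) + 10)
    (by positivity) hRC h2 fun t ht h3 h4 => halg.integral_roundRegret_le_of_late henv hp hcp
      hsel hM hMM' hM' hκ hσ₀ hd hK hKN hKκ hr (Finset.mem_Icc.1 ht).2 h3 h4).trans ?_
  rw [regretConst, mul_assoc]
  refine mul_le_mul_of_nonneg_left ?_ (by positivity)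
  have hE : 0 ≤ 1 + 1 / σ₀ * (1 / σ₀ + 1) := by positivity
  rw [← Real.sqrt_mul hE]
  -- After squaring, one of the two factors `log T` is exchanged for a multiple of `d log (T / d)`.
  refine Real.le_sqrt_of_sq_le ?_
  rw [mul_pow, Real.sq_sqrt (by positivity)]
  have h5 := log_le_mul_log_div hd hT hdD
  have h6 : 0 ≤ Real.log T * (T * Real.log ((T : ℝ) * N)) := by positivity
  calc Real.log T ^ 2 * (T * Real.log ((T : ℝ) * N)) =
      Real.log T * (Real.log T * (T * Real.log ((T : ℝ) * N))) := by ring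
    _ ≤ (1 + 1 / σ₀ * (1 / σ₀ + 1)) * (d * Real.log ((T : ℝ) / d)) *
        (Real.log T * (T * Real.log ((T : ℝ) * N))) := mul_le_mul_of_nonneg_right h5 h6
    _ = _ := by ring

end Main

end

end DBLMNL

theorem mainTheorem3 (κ σ₀ ρ₀ : ℝ) (hκ : 0 < κ) (hσ₀ : 0 < σ₀) :
    ∃ (B : ℕ → ℝ) (C : ℝ → ℝ),
      ∀ (N d K : ℕ) (p : Measure (DBLMNL.Vec d)) (θstar : DBLMNL.Vec d) (r : ℝ)
        (sel : (Fin N → ℝ) → Finset (Fin N))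
        (Ω : Type*) (_ : MeasurableSpace Ω) (P : Measure Ω)
        (x : ℕ → Ω → Fin N → DBLMNL.Vec d) (S : ℕ → Ω → Finset (Fin N))
        (c : ℕ → Ω → Option (Fin N)) (θhat : ℕ → Ω → DBLMNL.Vec d),
        1 ≤ d → 1 ≤ K → K ≤ N → (K : ℝ) ≤ 18 / κ ^ 4 → |r| ≤ 1 →
        IsProbabilityMeasure p → IsProbabilityMeasure P →
        DBLMNL.BoundedContexts p σ₀ →
        DBLMNL.ChoiceProbBound N K p θstar κ →
        DBLMNL.RelaxedSymmetry p ρ₀ →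
        DBLMNL.IsArgmaxRule K (fun _ => r) sel →
        DBLMNL.IsEnvironment P p θstar x S c →
        DBLMNL.IsDBLMNL P K κ σ₀ sel x S c θhat →
        DBLMNL.DiversityConstant N K p (B N) ∧
        ∀ T : ℕ, d < T →
          Integrable (DBLMNL.regret K (fun _ => r) θstar x S T) P ∧
          ∀ M : ℝ, DBLMNL.DiversityConstant N K p M →
            ∫ ω, DBLMNL.regret K (fun _ => r) θstar x S T ω ∂P ≤
              C M * Real.sqrt (d * T * Real.log ((T : ℝ) / d) * Real.log ((T : ℝ) * N) *
                Real.log T) := by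
  -- Passing to `max M 1` supplies the positivity needed for divisions without a sign condition on
  -- `M`.
  refine ⟨fun N => (2 / σ₀) ^ (N + 1), fun M => DBLMNL.regretConst κ σ₀ (max M 1), ?_⟩
  intro N d K p θstar r sel Ω _ P x S c θhat hd hK hKN hKκ hr _ _ hp hcp _ hsel henv halg
  refine ⟨DBLMNL.diversityConstant_pow hσ₀ hp K, fun T hT =>
    ⟨DBLMNL.integrable_regret henv halg.measurable_assortment hr T, fun M hM => ?_⟩⟩
  exact halg.integral_regret_le henv hp hcp hsel hM (le_max_left M 1)
    (lt_max_of_lt_right one_pos) hκ hσ₀ hd hK hKN hKκ hr hT
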